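/- Let $k$ be a field of characteristic $p\ge 3$. For a Lie algebra $L$ over $k$ and $x,y\in L$ put $\Lambda_p(x,y)=\sum_{i=1}^{p-1}\frac1i s_i(x,y)$, where $s_i(x,y)$ is the coefficient of $t^{i-1}$ in $\mathrm{ad}_{tx+y}^{p-1}(x)$. A restricted Lie algebra is a Lie algebra $L$ over $k$ with a map $x\mapsto x^{[p]}$ ($p$-map) such that $\mathrm{ad}_x^p=\mathrm{ad}_{x^{[p]}}$, $(\lambda x)^{[p]}=\lambda^p x^{[p]}$ and $(x+y)^{[p]}=x^{[p]}+y^{[p]}+\Lambda_p(x,y)$ for all $x,y\in L$, $\lambda\in k$. A weakly restricted Poisson algebra is a commutative Poisson algebra $(A,\cdot,\{-,-\})$ over $k$ with a map $x\mapsto x^{\{p\}}$ making $(A,\{-,-\})$ a restricted Lie algebra; it is a restricted Poisson algebra if moreover $(x^2)^{\{p\}}=2x^p x^{\{p\}}$ for all $x\in A$. For a Poisson algebra $A$, the Kähler differentials $\Omega_{A/k}$ with $$[x\,du,\,y\,dv]=x\{u,y\}\,dv+y\{x,v\}\,du+xy\,d\{u,v\},\qquad \alpha(x\,du)(z)=x\{u,z\}$$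 form a Lie–Rinehart algebra $(A,\Omega_{A/k})$ with anchor $\alpha:\Omega_{A/k}\to\mathrm{Der}_k(A)$; write $X(a)=\alpha(X)(a)$ and $X^{n}(a)=\alpha(X)^n(a)$. A restricted Lie–Rinehart algebra (in the sense of Dokas) is a Lie–Rinehart algebra $(A,L)$ over $k$ with a $p$-map making $L$ a restricted Lie algebra over $k$, such that the anchor satisfies $\alpha(X^{[p]})=\alpha(X)^p$ and $(aX)^{[p]}=a^pX^{[p]}+(aX)^{p-1}(a)X$ for all $a\in A$, $X\in L$. **Theorem.** Let $(A,\cdot,\{-,-\},(-)^{\{p\}})$ be a weakly restricted Poisson algebra over $k$ such that $\Omega_{A/k}$ is a free $A$-module. 1. There is a $p$-map on $\Omega_{A/k}$ making $(A,\Omega_{A/k})$ a restricted Lie–Rinehart algebra. 2. If $(du_i)_{i\in I}$ is an $A$-basis of $\Omega_{A/k}$ for some $u_i\in A$, then there is exactly one such $p$-map with $$(x\,du_i)^{[p]}=x^p\,d(u_i^{\{p\}})+(x\,du_i)^{p-1}(x)\,du_i\qquad\text{for all }x\in A,\ i\in I.$$ 3. If $A$ is a restricted Poisson algebra, then there is exactly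 one such $p$-map with $$(x\,du)^{[p]}=x^p\,d(u^{\{p\}})+(x\,du)^{p-1}(x)\,du\qquad\text{for all }x,u\in A.$$ -/

import Mathlib

open scoped KaehlerDifferential

noncomputable section

/-! ### Restricted Lie algebras -/

/-- `jacobsonCoeff x y n j` is the coefficient of `t ^ j` in the formal expression
`(ad (t x + y)) ^ n (x)`, computed in the Lie algebra of polynomials in `t` with coefficients
in `L`: applying `ad (t x + y)` once more raises the degree in `t` by one on the `ad x` part
and keeps it on the `ad y` part. -/
def jacobsonCoeff {L : Type*} [LieRing L] (x y : L) : ℕ → ℕ → L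
  | 0, 0 => x
  | 0, _ + 1 => 0
  | n + 1, 0 => ⁅y, jacobsonCoeff x y n 0⁆
  | n + 1, j + 1 => ⁅x, jacobsonCoeff x y n j⁆ + ⁅y, jacobsonCoeff x y n (j + 1)⁆

/-- `Λ_p(x, y) = ∑_{i = 1}^{p - 1} s_i(x, y) / i`, where `s_i(x, y)` is the coefficient of
`t ^ (i - 1)` in `(ad (t x + y)) ^ (p - 1) (x)`. -/
def jacobsonSum (k : Type*) {L : Type*} [Field k] [LieRing L] [LieAlgebra k L] (p : ℕ)
    (x y : L) : L :=
  ∑ i ∈ Finset.Icc 1 (p - 1), (i : k)⁻¹ • jacobsonCoeff x y (p - 1) (i - 1)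

/-- `(L, φ)` is a restricted Lie algebra over `k` (of characteristic `p`) with `p`-map `φ`. -/
structure IsPMap (k : Type*) {L : Type*} [Field k] [LieRing L] [LieAlgebra k L] (p : ℕ)
    (φ : L → L) : Prop where
  ad_pow : ∀ x : L, LieAlgebra.ad k L x ^ p = LieAlgebra.ad k L (φ x)
  map_smul : ∀ (c : k) (x : L), φ (c • x) = c ^ p • φ x
  map_add : ∀ x y : L, φ (x + y) = φ x + φ y + jacobsonSum k p x y

/-- The Lie–Rinehart algebra `(A, L)` over `k` (with the anchor given by the action of `L` on `A`)
together with `φ` is a restricted Lie–Rinehart algebra. -/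
structure IsRestrictedLieRinehart (k A : Type*) {L : Type*} [Field k] [CommRing A] [Algebra k A]
    [LieRing L] [LieAlgebra k L] [Module A L] [LieRingModule L A] [LieRinehartRing A L]
    [LieRinehartAlgebra k A L] (p : ℕ) (φ : L → L) : Prop where
  isPMap : IsPMap k p φ
  /-- The anchor `L → Der_k(A)` takes `φ` to the `p`-map `D ↦ D ^ p` of `Der_k(A)`. -/
  anchor_map : ∀ X : L, (LieRinehartAlgebra.anchor k A L (φ X) : A →ₗ[k] A) =
    (LieRinehartAlgebra.anchor k A L X : Module.End k A) ^ p
  map_smul : ∀ (a : A) (X : L), φ (a • X) =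
    a ^ p • φ X + ((LieRinehartAlgebra.anchor k A L (a • X) : Module.End k A) ^ (p - 1)) a • X

/-! ### Poisson algebras -/

/-- A commutative ring with a Lie bracket (over the integers) that satisfies the Leibniz rule. -/
class PoissonRing (A : Type*) extends CommRing A, LieRing A where
  mul_lie' : ∀ x y z : A, ⁅x * y, z⁆ = x * ⁅y, z⁆ + y * ⁅x, z⁆

/-- A commutative Poisson algebra over `k`: a Poisson ring that is a `k`-algebra, with
`k`-bilinear bracket (linearity in the first variable follows from skew-symmetry). -/
class PoissonAlgebra (k A : Type*) [CommRing k] [PoissonRing A] extends Algebra k A where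
  lie_smul' : ∀ (c : k) (x y : A), ⁅x, c • y⁆ = c • ⁅x, y⁆

namespace PoissonAlgebra

variable {k A : Type*} [CommRing k] [PoissonRing A] [PoissonAlgebra k A]

instance instLieAlgebra : LieAlgebra k A where
  lie_smul := lie_smul'

theorem lie_mul (x y z : A) : ⁅x, y * z⁆ = y * ⁅x, z⁆ + z * ⁅x, y⁆ := by
  rw [← lie_skew, PoissonRing.mul_lie', ← lie_skew x z, ← lie_skew x y]; ring

variable (k) in
/-- The derivation `{a, -}`. -/
def hamiltonian (a : A) : Derivation k A A :=
  Derivation.mk' (LieAlgebra.ad k A a) fun x y => by simp [lie_mul]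

@[simp] theorem hamiltonian_apply (a x : A) : hamiltonian k a x = ⁅a, x⁆ := rfl

variable (k A) in
/-- `a ↦ {a, -}` as a derivation of `A` with values in `Der_k(A)`. -/
def hamiltonianDer : Derivation k A (Derivation k A A) :=
  Derivation.mk'
    { toFun := hamiltonian k
      map_add' := fun a b => by ext x; simp
      map_smul' := fun c a => by ext x; simp }
    fun a b => by ext x; simp [PoissonRing.mul_lie']

@[simp] theorem hamiltonianDer_apply (a x : A) : hamiltonianDer k A a x = ⁅a, x⁆ := rfl

variable (k A) in
/-- The anchor `α(x du) = x {u, -}` of the Kähler differentials. -/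
def omegaAnchor : Ω[A⁄k] →ₗ[A] Derivation k A A :=
  (hamiltonianDer k A).liftKaehlerDifferential

@[simp] theorem omegaAnchor_D (u : A) :
    omegaAnchor k A (KaehlerDifferential.D k A u) = hamiltonian k u :=
  Derivation.liftKaehlerDifferential_comp_D _ u

/-- The anchor on generators. -/
theorem omegaAnchor_smul_D (x u z : A) :
    omegaAnchor k A (x • KaehlerDifferential.D k A u) z = x * ⁅u, z⁆ := by
  simp [omegaAnchor]

end PoissonAlgebra

/-! ### The Lie derivative on Kähler differentials -/

section LieDerivative

variable {k A : Type*} [CommRing k] [CommRing A] [Algebra k A]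

theorem kaehler_induction {P : Ω[A⁄k] → Prop} (h0 : P 0)
    (hadd : ∀ a b, P a → P b → P (a + b))
    (hD : ∀ x u : A, P (x • KaehlerDifferential.D k A u)) (ω : Ω[A⁄k]) : P ω := by
  obtain ⟨f, rfl⟩ := KaehlerDifferential.linearCombination_surjective k A ω
  induction f using Finsupp.induction_linear with
  | zero => simpa using h0
  | add f g hf hg => rw [map_add]; exact hadd _ _ hf hg
  | single u x => simpa using hD x u

/-- Auxiliary map: `single v y ↦ X y • dv + y • d (X v)`. -/
def lieDerivativeAux (X : Derivation k A A) : (A →₀ A) →ₗ[k] Ω[A⁄k] :=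
  Finsupp.lsum k fun v =>
    ((LinearMap.toSpanSingleton A Ω[A⁄k] (KaehlerDifferential.D k A v)).restrictScalars k) ∘ₗ
      (X : A →ₗ[k] A) +
    (LinearMap.toSpanSingleton A Ω[A⁄k] (KaehlerDifferential.D k A (X v))).restrictScalars k

@[simp] theorem lieDerivativeAux_single (X : Derivation k A A) (v y : A) :
    lieDerivativeAux X (Finsupp.single v y) =
      X y • KaehlerDifferential.D k A v + y • KaehlerDifferential.D k A (X v) := by
  simp [lieDerivativeAux]

theorem lieDerivativeAux_smul (X : Derivation k A A) (a : A) (f : A →₀ A) :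
    lieDerivativeAux X (a • f) = a • lieDerivativeAux X f +
      X a • Finsupp.linearCombination A (KaehlerDifferential.D k A) f := by
  induction f using Finsupp.induction_linear with
  | zero => simp
  | add f g hf hg => rw [smul_add, map_add, hf, hg, map_add, map_add]; module
  | single v y =>
    simp only [Finsupp.smul_single, lieDerivativeAux_single, Finsupp.linearCombination_single,
      smul_eq_mul, Derivation.leibniz]
    module

theorem lieDerivativeAux_kerTotal (X : Derivation k A A) :
    (KaehlerDifferential.kerTotal k A).restrictScalars k ≤ LinearMap.ker (lieDerivativeAux X) := by
  intro f hf
  have h : Finsupp.linearCombination A (KaehlerDifferential.D k A) f = 0 ∧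
      lieDerivativeAux X f = 0 := by
    rw [Submodule.restrictScalars_mem, KaehlerDifferential.kerTotal] at hf
    induction hf using Submodule.span_induction with
    | zero => simp
    | add f g _ _ hf hg => simp [hf.1, hf.2, hg.1, hg.2]
    | smul a f _ hf => simp [lieDerivativeAux_smul, hf.1, hf.2]
    | mem f hf =>
      rcases hf with (⟨⟨a, b⟩, rfl⟩ | ⟨⟨a, b⟩, rfl⟩) | ⟨c, rfl⟩
      · simp
      · simp; module
      · simp
  exact h.2

/-- The Lie derivative `L_X` on `Ω[A⁄k]`: the `k`-linear map with
`L_X (y dv) = X(y) dv + y d(X(v))`. -/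
def lieDerivative (X : Derivation k A A) : Ω[A⁄k] →ₗ[k] Ω[A⁄k] :=
  (((KaehlerDifferential.kerTotal k A).restrictScalars k).liftQ (lieDerivativeAux X)
    (lieDerivativeAux_kerTotal X)) ∘ₗ
    ((KaehlerDifferential.quotKerTotalEquiv k A).symm.toLinearMap.restrictScalars k)

@[simp] theorem lieDerivative_smul_D (X : Derivation k A A) (y v : A) :
    lieDerivative X (y • KaehlerDifferential.D k A v) =
      X y • KaehlerDifferential.D k A v + y • KaehlerDifferential.D k A (X v) := by
  have h : (KaehlerDifferential.quotKerTotalEquiv k A).symm (y • KaehlerDifferential.D k A v) =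
      (KaehlerDifferential.kerTotal k A).mkQ (Finsupp.single v y) := by
    rw [LinearEquiv.symm_apply_eq]
    simp [KaehlerDifferential.quotKerTotalEquiv]
  refine Eq.trans ?_ (lieDerivativeAux_single X v y)
  exact congrArg (((KaehlerDifferential.kerTotal k A).restrictScalars k).liftQ
    (lieDerivativeAux X) (lieDerivativeAux_kerTotal X)) h

end LieDerivative

/-! ### The Lie–Rinehart algebra of Kähler differentials of a Poisson algebra -/

namespace PoissonAlgebra

variable {k A : Type*} [CommRing k] [PoissonRing A] [PoissonAlgebra k A]

/-- The bracket `[α, β] = L_{α♯} β - L_{β♯} α + d ⟨α, β♯⟩` on the Kähler differentials. -/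
instance instBracketOmega : Bracket Ω[A⁄k] Ω[A⁄k] where
  bracket α β := lieDerivative (omegaAnchor k A α) β - lieDerivative (omegaAnchor k A β) α +
    KaehlerDifferential.D k A ((omegaAnchor k A β).liftKaehlerDifferential α)

theorem omega_lie_def (α β : Ω[A⁄k]) :
    ⁅α, β⁆ = lieDerivative (omegaAnchor k A α) β - lieDerivative (omegaAnchor k A β) α +
      KaehlerDifferential.D k A ((omegaAnchor k A β).liftKaehlerDifferential α) := rfl

/-- The bracket on generators:
`[x du, y dv] = x {u, y} dv + y {x, v} du + x y d{u, v}`. -/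
theorem omega_lie_smul_D (x u y v : A) :
    ⁅x • KaehlerDifferential.D k A u, y • KaehlerDifferential.D k A v⁆ =
      (x * ⁅u, y⁆) • KaehlerDifferential.D k A v + (y * ⁅x, v⁆) • KaehlerDifferential.D k A u +
        (x * y) • KaehlerDifferential.D k A ⁅u, v⁆ := by
  rw [omega_lie_def, lieDerivative_smul_D, lieDerivative_smul_D]
  simp only [map_smul, Derivation.liftKaehlerDifferential_comp_D, omegaAnchor_D,
    Derivation.smul_apply, hamiltonian_apply, Derivation.leibniz, smul_eq_mul]
  rw [← lie_skew u v, ← lie_skew x v]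
  simp only [map_neg]
  module

theorem lieDerivative_add_left (X Y : Derivation k A A) (ω : Ω[A⁄k]) :
    lieDerivative (X + Y) ω = lieDerivative X ω + lieDerivative Y ω := by
  induction ω using kaehler_induction with
  | h0 => simp
  | hadd a b ha hb => simp only [map_add, ha, hb]; abel
  | hD x u => simp only [lieDerivative_smul_D, Derivation.add_apply, map_add]; module

theorem liftKaehlerDifferential_add (X Y : Derivation k A A) (ω : Ω[A⁄k]) :
    (X + Y).liftKaehlerDifferential ω =
      X.liftKaehlerDifferential ω + Y.liftKaehlerDifferential ω := by
  induction ω using kaehler_induction with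
  | h0 => simp
  | hadd a b ha hb => simp only [map_add, ha, hb]; abel
  | hD x u =>
    simp only [map_smul, Derivation.liftKaehlerDifferential_comp_D, Derivation.add_apply, smul_add]

theorem omega_add_lie (α β γ : Ω[A⁄k]) : ⁅α + β, γ⁆ = ⁅α, γ⁆ + ⁅β, γ⁆ := by
  simp only [omega_lie_def, map_add, lieDerivative_add_left]; abel

theorem omega_lie_add (α β γ : Ω[A⁄k]) : ⁅α, β + γ⁆ = ⁅α, β⁆ + ⁅α, γ⁆ := by
  simp only [omega_lie_def, map_add, lieDerivative_add_left, liftKaehlerDifferential_add]; abel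

theorem omega_zero_lie (α : Ω[A⁄k]) : ⁅(0 : Ω[A⁄k]), α⁆ = 0 := by
  simpa using omega_add_lie 0 0 α

theorem omega_lie_zero (α : Ω[A⁄k]) : ⁅α, (0 : Ω[A⁄k])⁆ = 0 := by
  simpa using omega_lie_add α 0 0

theorem omega_lie_skew (α β : Ω[A⁄k]) : ⁅α, β⁆ = -⁅β, α⁆ := by
  induction α using kaehler_induction with
  | h0 => simp [omega_zero_lie, omega_lie_zero]
  | hadd a b ha hb => rw [omega_add_lie, omega_lie_add, ha, hb]; abel
  | hD x u =>
    induction β using kaehler_induction with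
    | h0 => simp [omega_zero_lie, omega_lie_zero]
    | hadd a b ha hb => rw [omega_add_lie, omega_lie_add, ha, hb]; abel
    | hD y v =>
      rw [omega_lie_smul_D, omega_lie_smul_D, ← lie_skew u v, ← lie_skew u y, ← lie_skew x v,
        map_neg]
      module

theorem omega_lie_self (α : Ω[A⁄k]) : ⁅α, α⁆ = 0 := by
  induction α using kaehler_induction with
  | h0 => exact omega_lie_zero 0
  | hadd a b ha hb =>
    rw [omega_add_lie, omega_lie_add, omega_lie_add, ha, hb, omega_lie_skew a b]; abel
  | hD x u =>
    rw [omega_lie_smul_D, ← lie_skew x u, lie_self, map_zero]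
    module

theorem omega_lie_smul (α β : Ω[A⁄k]) (a : A) :
    ⁅α, a • β⁆ = a • ⁅α, β⁆ + omegaAnchor k A α a • β := by
  induction α using kaehler_induction with
  | h0 => simp [omega_zero_lie]
  | hadd α α' h h' =>
    rw [omega_add_lie, omega_add_lie, h, h', map_add, Derivation.add_apply]; module
  | hD x u =>
    induction β using kaehler_induction with
    | h0 => simp [omega_lie_zero]
    | hadd β β' h h' => rw [smul_add, omega_lie_add, h, h', omega_lie_add]; module
    | hD y v =>
      rw [← mul_smul, omega_lie_smul_D, omega_lie_smul_D, omegaAnchor_smul_D, lie_mul]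
      module

theorem omegaAnchor_lie (α β : Ω[A⁄k]) :
    omegaAnchor k A ⁅α, β⁆ = ⁅omegaAnchor k A α, omegaAnchor k A β⁆ := by
  induction α using kaehler_induction with
  | h0 => simp [omega_zero_lie]
  | hadd a b ha hb => rw [omega_add_lie, map_add, ha, hb, map_add, add_lie]
  | hD x u =>
    induction β using kaehler_induction with
    | h0 => simp [omega_lie_zero]
    | hadd a b ha hb => rw [omega_lie_add, map_add, ha, hb, map_add, lie_add]
    | hD y v =>
      ext z
      rw [omega_lie_smul_D]
      simp only [map_add, map_smul, omegaAnchor_D, Derivation.add_apply, Derivation.smul_apply,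
        hamiltonian_apply, Derivation.commutator_apply, smul_eq_mul, lie_mul, lie_lie]
      rw [← lie_skew x v]
      ring

theorem omega_leibniz_lie (α β γ : Ω[A⁄k]) : ⁅α, ⁅β, γ⁆⁆ = ⁅⁅α, β⁆, γ⁆ + ⁅β, ⁅α, γ⁆⁆ := by
  -- the defect is linear over `A` in the last argument, hence in each argument
  have key : ∀ (α β γ : Ω[A⁄k]) (a : A),
      ⁅α, ⁅β, a • γ⁆⁆ - ⁅⁅α, β⁆, a • γ⁆ - ⁅β, ⁅α, a • γ⁆⁆ =
        a • (⁅α, ⁅β, γ⁆⁆ - ⁅⁅α, β⁆, γ⁆ - ⁅β, ⁅α, γ⁆⁆) := by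
    intro α β γ a
    simp only [omega_lie_smul, omega_lie_add, omegaAnchor_lie, Derivation.commutator_apply]
    module
  have smul_last : ∀ (α β γ : Ω[A⁄k]) (a : A), ⁅α, ⁅β, γ⁆⁆ = ⁅⁅α, β⁆, γ⁆ + ⁅β, ⁅α, γ⁆⁆ →
      ⁅α, ⁅β, a • γ⁆⁆ = ⁅⁅α, β⁆, a • γ⁆ + ⁅β, ⁅α, a • γ⁆⁆ := by
    intro α β γ a h
    have := key α β γ a
    rw [h, add_sub_cancel_left, sub_self, smul_zero, sub_sub, sub_eq_zero] at this
    exact this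
  have cyc : ∀ α β γ : Ω[A⁄k], ⁅α, ⁅β, γ⁆⁆ = ⁅⁅α, β⁆, γ⁆ + ⁅β, ⁅α, γ⁆⁆ →
      ⁅β, ⁅γ, α⁆⁆ = ⁅⁅β, γ⁆, α⁆ + ⁅γ, ⁅β, α⁆⁆ := by
    intro α β γ h
    have hneg : ∀ a b : Ω[A⁄k], ⁅a, -b⁆ = -⁅a, b⁆ := fun a b =>
      eq_neg_of_add_eq_zero_left (by rw [← omega_lie_add]; simp [omega_lie_zero])
    have hneg' : ∀ a b : Ω[A⁄k], ⁅-a, b⁆ = -⁅a, b⁆ := fun a b =>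
      eq_neg_of_add_eq_zero_left (by rw [← omega_add_lie]; simp [omega_zero_lie])
    rw [omega_lie_skew ⁅β, γ⁆ α, omega_lie_skew γ ⁅β, α⁆, omega_lie_skew γ α, hneg, h,
      omega_lie_skew β α, hneg']
    abel
  have hDDD : ∀ u v w : A, ⁅KaehlerDifferential.D k A u,
      ⁅KaehlerDifferential.D k A v, KaehlerDifferential.D k A w⁆⁆ =
        ⁅⁅KaehlerDifferential.D k A u, KaehlerDifferential.D k A v⁆, KaehlerDifferential.D k A w⁆ +
        ⁅KaehlerDifferential.D k A v, ⁅KaehlerDifferential.D k A u, KaehlerDifferential.D k A w⁆⁆ := by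
    have hD : ∀ u v : A, ⁅KaehlerDifferential.D k A u, KaehlerDifferential.D k A v⁆ =
        KaehlerDifferential.D k A ⁅u, v⁆ := by
      intro u v
      have h1 : ∀ x : A, ⁅x, (1 : A)⁆ = 0 := fun x => by
        simpa using lie_mul x 1 1
      have h1' : ∀ x : A, ⁅(1 : A), x⁆ = 0 := fun x => by rw [← lie_skew, h1, neg_zero]
      simpa [h1, h1'] using omega_lie_smul_D (k := k) 1 u 1 v
    intro u v w
    simp only [hD, ← map_add]
    rw [leibniz_lie]
  induction γ using kaehler_induction with
  | h0 => simp [omega_lie_zero]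
  | hadd a b ha hb => simp only [omega_lie_add, ha, hb]; abel
  | hD z w =>
    induction β using kaehler_induction with
    | h0 => simp [omega_lie_zero, omega_zero_lie]
    | hadd a b ha hb => simp only [omega_lie_add, omega_add_lie, ha, hb]; abel
    | hD y v =>
      induction α using kaehler_induction with
      | h0 => simp [omega_lie_zero, omega_zero_lie]
      | hadd a b ha hb => simp only [omega_lie_add, omega_add_lie, ha, hb]; abel
      | hD x u =>
        exact cyc _ _ _ (smul_last _ _ _ y (cyc _ _ _ (smul_last _ _ _ x
          (cyc _ _ _ (smul_last _ _ _ z (hDDD u v w))))))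

/-- The Lie ring structure on the Kähler differentials of a Poisson algebra. -/
instance instLieRingOmega : LieRing Ω[A⁄k] where
  add_lie := omega_add_lie
  lie_add := omega_lie_add
  lie_self := omega_lie_self
  leibniz_lie := omega_leibniz_lie

instance instLieAlgebraOmega : LieAlgebra k Ω[A⁄k] where
  lie_smul c α β := by
    have h := omega_lie_smul α β (algebraMap k A c)
    simpa only [algebraMap_smul, Derivation.map_algebraMap, zero_smul, add_zero] using h

/-- The action of the Kähler differentials on `A` through the anchor:
`(x du) . a = x {u, a}`. -/
instance instLieRingModuleOmega : LieRingModule Ω[A⁄k] A where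
  bracket α a := omegaAnchor k A α a
  add_lie α β a := by rw [map_add]; rfl
  lie_add α a b := map_add _ a b
  leibniz_lie α β a := by
    rw [omegaAnchor_lie, Derivation.commutator_apply, sub_add_cancel]

theorem omega_lie_apply (α : Ω[A⁄k]) (a : A) : ⁅α, a⁆ = omegaAnchor k A α a := rfl

instance instLieRinehartRingOmega : LieRinehartRing A Ω[A⁄k] where
  lie_smul_eq_mul' a b α := by simp [omega_lie_apply]
  leibniz_mul_right' α a b := by simp [omega_lie_apply, mul_comm]
  leibniz_smul_right' α β a := omega_lie_smul α β a

/-- The Lie–Rinehart algebra `(A, Ω[A⁄k])` of a Poisson algebra `A`. -/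
instance instLieRinehartAlgebraOmega : LieRinehartAlgebra k A Ω[A⁄k] where
  smul_lie c α a := by
    rw [omega_lie_apply, omega_lie_apply, ← algebraMap_smul A c α, map_smul, Derivation.smul_apply,
      algebraMap_smul]
  lie_smul c α a := by simp [omega_lie_apply]

end PoissonAlgebra

/-- `φ` is a weakly restricted Poisson structure on `A`: it makes the Lie algebra `(A, {-,-})`
a restricted Lie algebra. -/
def IsWeaklyRestrictedPoisson (k : Type*) {A : Type*} [Field k] [PoissonRing A]
    [PoissonAlgebra k A] (p : ℕ) (φ : A → A) : Prop :=
  IsPMap k p φ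

/-- `φ` is a restricted Poisson structure on `A`. -/
structure IsRestrictedPoisson (k : Type*) {A : Type*} [Field k] [PoissonRing A]
    [PoissonAlgebra k A] (p : ℕ) (φ : A → A) : Prop where
  weaklyRestricted : IsWeaklyRestrictedPoisson k p φ
  map_sq : ∀ x : A, φ (x ^ 2) = 2 * x ^ p * φ x

end

open Polynomial
open scoped TensorProduct

/-! ### Hochschild's formula in associative rings -/

/-! For a Lie–Rinehart algebra L, let E be the set of pairs (X, Y) in L × L, where Y is a candidate
for X^[p]. Jacobson's formula dictates an addition on E and Hochschild's formula an action of A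
(`PowerPair`). Once E is an A-module, the maps obeying both formulas are the A-linear sections of
the projection E → L. The pairs for which ad and the anchor of Y are the p-th powers of those of X
form a submodule (`PowerPair.restricted`), so a restricted structure is a linear section with values
in it.

For a weakly restricted Poisson algebra the pairs (du, d(u^{p})) lie in this submodule, which
therefore maps onto Ω. If Ω is free, hence projective, a section exists. A basis of exact
differentials gives a section with prescribed values. In the restricted case u ↦ (du, d(u^{p})) is
itself a derivation, by polarising the rule for squares, and the universal property of Ω gives the
section. Uniqueness holds because a restricted structure is determined by its values on generators.

The work lies in the module axioms of E, which are identities in L and are proved without embedding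
L in an enveloping algebra. For a derivation θ, the value of θ on a formal power X^p should be
ad_X^{p-1}(θ X), and this is an honest element of L. Jacobson's and Hochschild's formulas
differentiated in this sense are `derivation_jacobsonSum` and `lieEnd_smul_pow_derivation`. After
extension of scalars to k[X], they show that d/dX kills the defect of each identity. A polynomial of
degree at most p with zero derivative is c_0 + c_p X^p, so its value at 1 is its value at 0 plus its
leading coefficient; both are defects with a zero argument, and these vanish
(`eq_add_of_polynomial_family`). Associativity of the action comes instead from expanding (a b D)^p
in two ways (`iterate_mul_derivation_mul`). -/

/-- `hochschildCoeff D a n j` is the coefficient of `D ^ j` in the expansion of `(a D) ^ n a`. -/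
def hochschildCoeff {k A : Type*} [CommRing k] [CommRing A] [Algebra k A] (D : Derivation k A A)
    (a : A) : ℕ → ℕ → A
  | 0, 0 => a
  | 0, _ + 1 => 0
  | n + 1, 0 => a * D (hochschildCoeff D a n 0)
  | n + 1, j + 1 => a * hochschildCoeff D a n j + a * D (hochschildCoeff D a n (j + 1))

section HochschildCoeff

variable {k A : Type*} [CommRing k] [CommRing A] [Algebra k A] (D : Derivation k A A) (a : A)

theorem hochschildCoeff_eq_zero {n j : ℕ} (h : n < j) : hochschildCoeff D a n j = 0 := by
  induction n generalizing j with
  | zero => obtain ⟨j, rfl⟩ := Nat.exists_eq_succ_of_ne_zero h.ne'; rfl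
  | succ n ih =>
    obtain ⟨j, rfl⟩ := Nat.exists_eq_succ_of_ne_zero (Nat.ne_zero_of_lt h)
    simp [hochschildCoeff, ih (Nat.lt_of_succ_lt_succ h),
      ih ((Nat.lt_of_succ_lt_succ h).trans (Nat.lt_succ_self j))]

theorem hochschildCoeff_self (n : ℕ) : hochschildCoeff D a n n = a ^ (n + 1) := by
  induction n with
  | zero => simp [hochschildCoeff]
  | succ n ih =>
    simp [hochschildCoeff, ih, hochschildCoeff_eq_zero D a (Nat.lt_succ_self n), pow_succ']

theorem hochschildCoeff_zero (n : ℕ) : hochschildCoeff D a n 0 = (fun b => a * D b)^[n] a := by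
  induction n with
  | zero => rfl
  | succ n ih => rw [Function.iterate_succ_apply', ← ih]; rfl

variable {D} {R : Type*} [Ring R] {ι : A →+* R} {x : R}

/-- Moving `x` to the right past a coefficient leaves a derivative behind, and the recursion of
`hochschildCoeff` records this. The trailing `ι a` makes the constant coefficient equal to `(a D) ^
n a`. -/
theorem mul_pow_mul_eq_sum (hx : ∀ b, x * ι b = ι b * x + ι (D b)) (n : ℕ) :
    (ι a * x) ^ n * ι a = ∑ j ∈ Finset.range (n + 1), ι (hochschildCoeff D a n j) * x ^ j := by
  induction n with
  | zero => simp [hochschildCoeff]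
  | succ n ih =>
    rw [pow_succ', mul_assoc, ih, Finset.mul_sum, Finset.sum_range_succ' _ (n + 1)]
    have h1 : ∀ j, ι a * x * (ι (hochschildCoeff D a n j) * x ^ j) =
        ι (a * hochschildCoeff D a n j) * x ^ (j + 1) +
          ι (a * D (hochschildCoeff D a n j)) * x ^ j := by
      intro j
      rw [mul_assoc, ← mul_assoc x, hx, map_mul, map_mul, pow_succ']
      noncomm_ring
    simp only [h1, hochschildCoeff, Finset.sum_add_distrib, map_add, add_mul]
    rw [Finset.sum_range_succ' (fun j => ι (a * D (hochschildCoeff D a n j)) * x ^ j),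
      Finset.sum_range_succ (fun j => ι (a * D (hochschildCoeff D a n (j + 1))) * x ^ (j + 1)) n,
      hochschildCoeff_eq_zero D a (Nat.lt_succ_self n)]
    simp [add_assoc]

end HochschildCoeff

theorem AddMonoid.End.mul_apply_eq {M : Type*} [AddCommMonoid M] (f g : AddMonoid.End M) (m : M) :
    (f * g) m = f (g m) := rfl

theorem AddMonoid.End.sum_apply {M ι : Type*} [AddCommMonoid M] (s : Finset ι)
    (f : ι → AddMonoid.End M) (m : M) : (∑ i ∈ s, f i) m = ∑ i ∈ s, f i m :=
  AddMonoidHom.finsetSum_apply f s m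

/-- The action of an element of a Lie ring on a Lie ring module, as an additive endomorphism. -/
def lieEnd {L : Type*} (M : Type*) [LieRing L] [AddCommGroup M] [LieRingModule L M] (x : L) :
    AddMonoid.End M :=
  AddMonoidHom.mk' (fun m => ⁅x, m⁆) (lie_add x)

@[simp] theorem lieEnd_apply {L M : Type*} [LieRing L] [AddCommGroup M] [LieRingModule L M] (x : L)
    (m : M) : lieEnd M x m = ⁅x, m⁆ := rfl

/-! ### Adjoint powers in associative rings of characteristic p. -/

section CharP

attribute [local instance] LieRing.ofAssociativeRing

variable {p : ℕ}

theorem sub_pow_prime_of_commute [Fact p.Prime] {R : Type*} [Ring R] (hR : (p : R) = 0) {x y : R}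
    (h : Commute x y) : (x - y) ^ p = x ^ p - y ^ p := by
  obtain ⟨r, hr⟩ := (h.sub_left (Commute.refl y)).exists_add_pow_prime_eq (Fact.out : p.Prime)
  rw [sub_add_cancel, hR] at hr
  rw [hr]; simp

theorem isUnit_natCast_of_coprime {R : Type*} [Ring R] (hR : (p : R) = 0) {n : ℕ}
    (h : n.Coprime p) : IsUnit (n : R) := by
  have := Nat.gcd_eq_gcd_ab n p
  rw [h.gcd_eq_one] at this
  have h2 := congrArg (Int.cast : ℤ → R) this
  push_cast [hR] at h2
  rw [zero_mul, add_zero] at h2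
  exact isUnit_iff_exists.2 ⟨_, h2.symm, by rw [← (Nat.cast_commute n _).eq, ← h2]⟩

/-- The adjoint map is the difference of left and right multiplication, which commute, so its p-th
power is the difference of their p-th powers. -/
theorem lieEnd_pow_prime [Fact p.Prime] {R : Type*} [Ring R] (hR : (p : R) = 0) (x : R) :
    lieEnd R x ^ p = lieEnd R (x ^ p) := by
  have hE : (p : AddMonoid.End R) = 0 := by
    ext r
    rw [AddMonoid.End.natCast_apply, nsmul_eq_mul, hR, zero_mul]; rfl
  let l : R → AddMonoid.End R := AddMonoidHom.mulLeft
  let r : R → AddMonoid.End R := AddMonoidHom.mulRight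
  have hlr : ∀ y, lieEnd R y = l y - r y := fun y => by ext z; rfl
  have hc : Commute (l x) (r x) := by
    ext z; exact (mul_assoc _ _ _).symm
  have hl : ∀ n : ℕ, l x ^ n = l (x ^ n) := by
    intro n
    induction n with
    | zero => ext z; rw [pow_zero, pow_zero]; exact (one_mul z).symm
    | succ n ih => rw [pow_succ', pow_succ', ih]; ext z; exact (mul_assoc _ _ _).symm
  have hr : ∀ n : ℕ, r x ^ n = r (x ^ n) := by
    intro n
    induction n with
    | zero => ext z; rw [pow_zero, pow_zero]; exact (mul_one z).symm
    | succ n ih => rw [pow_succ', pow_succ, ih]; ext z; exact mul_assoc _ _ _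
  rw [hlr, sub_pow_prime_of_commute hE hc, hl, hr, hlr]

variable [Fact p.Prime] {k A : Type*} [CommRing k] [CommRing A] [Algebra k A]
  {D : Derivation k A A} {R : Type*} [Ring R] {ι : A →+* R} {x : R}

theorem lieEnd_pow_apply_map (hx : ∀ b, x * ι b = ι b * x + ι (D b)) (n : ℕ) (b : A) :
    (lieEnd R x ^ n) (ι b) = ι (D^[n] b) := by
  induction n with
  | zero => rfl
  | succ n ih =>
    rw [pow_succ', AddMonoid.End.mul_apply_eq, ih, Function.iterate_succ_apply', lieEnd_apply,
      Ring.lie_def, hx, add_sub_cancel_left]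

/-- The commutator of `x ^ p` with `ι b` is the p-fold commutator of `x`. Thus `D^[p]` obeys the
Leibniz rule in operator form. -/
theorem pow_prime_mul (hR : (p : R) = 0) (hx : ∀ b, x * ι b = ι b * x + ι (D b)) (b : A) :
    x ^ p * ι b = ι b * x ^ p + ι (D^[p] b) := by
  rw [← lieEnd_pow_apply_map hx, lieEnd_pow_prime hR, lieEnd_apply, Ring.lie_def]
  abel

end CharP

/-! ### Derivations of A[X] and Hochschild's formula. -/

section PolynomialExtension

variable {k A : Type*} [CommRing k] [CommRing A] [Algebra k A]

/-- The derivation of `A[X]` acting as `D` on the coefficients, with `X ↦ 0`. -/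
noncomputable def Derivation.polynomialCoeff (D : Derivation k A A) : Derivation k A[X] A[X] :=
  PolynomialModule.equivPolynomialSelf.compDer D.mapCoeffs

@[simp] theorem Derivation.polynomialCoeff_C (D : Derivation k A A) (b : A) :
    D.polynomialCoeff (C b) = C (D b) := by
  ext n
  change D (coeff (C b) n) = _
  rw [coeff_C, coeff_C]; split_ifs <;> simp

@[simp] theorem Derivation.polynomialCoeff_X (D : Derivation k A A) :
    D.polynomialCoeff (X : A[X]) = 0 := by
  ext n
  change D (coeff X n) = _
  rw [coeff_X]; split_ifs <;> simp

/-- The derivation of `A[X]` extending `D` with `X ↦ 1`. -/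
noncomputable def Derivation.polynomialExtend (D : Derivation k A A) : Derivation k A[X] A[X] :=
  D.polynomialCoeff + (derivative' (R := A)).restrictScalars k

@[simp] theorem Derivation.polynomialExtend_C (D : Derivation k A A) (b : A) :
    D.polynomialExtend (C b) = C (D b) := by
  simp [Derivation.polynomialExtend]

@[simp] theorem Derivation.polynomialExtend_X (D : Derivation k A A) :
    D.polynomialExtend (X : A[X]) = 1 := by
  simp [Derivation.polynomialExtend]

/-- A derivation of a commutative ring as an element of the ring of its additive endomorphisms. -/
def Derivation.toAddEnd (D : Derivation k A A) : AddMonoid.End A :=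
  (D : A →ₗ[k] A).toAddMonoidHom

@[simp] theorem Derivation.toAddEnd_apply (D : Derivation k A A) (b : A) : D.toAddEnd b = D b := rfl

theorem Derivation.toAddEnd_mul (D : Derivation k A A) (b : A) :
    D.toAddEnd * Module.toAddMonoidEnd A A b =
      Module.toAddMonoidEnd A A b * D.toAddEnd + Module.toAddMonoidEnd A A (D b) := by
  ext z
  change D (b * z) = b * D z + D b * z
  rw [D.leibniz]; simp [mul_comm z]

variable (A) in
/-- `A` acting on `A[X]` by multiplication. -/
noncomputable def polynomialMul : A →+* AddMonoid.End A[X] :=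
  (Module.toAddMonoidEnd A[X] A[X]).comp C

@[simp] theorem polynomialMul_apply (b : A) (f : A[X]) : polynomialMul A b f = C b * f := rfl

theorem polynomialExtend_mul (D : Derivation k A A) (b : A) :
    D.polynomialExtend.toAddEnd * polynomialMul A b =
      polynomialMul A b * D.polynomialExtend.toAddEnd + polynomialMul A (D b) := by
  have := D.polynomialExtend.toAddEnd_mul (C b)
  rwa [D.polynomialExtend_C] at this

theorem polynomialCoeff_mul (D : Derivation k A A) (b : A) :
    D.polynomialCoeff.toAddEnd * polynomialMul A b =
      polynomialMul A b * D.polynomialCoeff.toAddEnd + polynomialMul A (D b) := by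
  have := D.polynomialCoeff.toAddEnd_mul (C b)
  rwa [D.polynomialCoeff_C] at this

theorem polynomialExtend_pow_X_pow (D : Derivation k A A) (j m : ℕ) :
    (D.polynomialExtend.toAddEnd ^ j) (X ^ m) = (m.descFactorial j : A[X]) * X ^ (m - j) := by
  induction j with
  | zero => simp
  | succ j ih =>
    rw [pow_succ', AddMonoid.End.mul_apply_eq, ih, Derivation.toAddEnd_apply, Derivation.leibniz,
      Derivation.leibniz_pow, Derivation.map_natCast, D.polynomialExtend_X, Nat.descFactorial_succ]
    simp only [smul_eq_mul, nsmul_eq_mul, mul_one, mul_zero, add_zero]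
    push_cast
    rw [Nat.sub_sub]; ring

variable {p : ℕ}

theorem natCast_addEnd_eq_zero {M : Type*} [AddCommGroup M] [Module A M] (hA : (p : A) = 0) :
    (p : AddMonoid.End M) = 0 := by
  rw [← map_natCast (Module.toAddMonoidEnd A M), hA, map_zero]

variable [Fact p.Prime]

/-- Extending `D` to A[X] by X ↦ 1 makes the powers of the derivation distinguishable on powers of
X. The p-th power of `a` times the extension is again a derivation, which leaves no room for the
intermediate orders. -/
theorem hochschildCoeff_prime_sub_one (hA : (p : A) = 0) (D : Derivation k A A) (a : A) {j : ℕ}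
    (h0 : 0 < j) (hj : j < p - 1) : hochschildCoeff D a (p - 1) j = 0 := by
  have hp : p - 1 + 1 = p := Nat.sub_add_cancel (Fact.out : p.Prime).one_le
  set x := D.polynomialExtend.toAddEnd with hx
  let Δ : Derivation k A[X] A[X] := C a • D.polynomialExtend
  have hΔ : Δ.toAddEnd = polynomialMul A a * x := rfl
  have hR : (p : AddMonoid.End A[X]) = 0 :=
    natCast_addEnd_eq_zero (A := A) hA
  have hsum : Δ.toAddEnd ^ p =
      ∑ i ∈ Finset.range p, polynomialMul A (hochschildCoeff D a (p - 1) i) * x ^ (i + 1) := by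
    have := mul_pow_mul_eq_sum a (polynomialExtend_mul D) (p - 1)
    rw [hp] at this
    rw [hΔ, ← hp, pow_succ, ← mul_assoc, hp, this, Finset.sum_mul]
    simp only [mul_assoc, pow_succ]
    rfl
  have hleib := pow_prime_mul (D := Δ) hR Δ.toAddEnd_mul X
  have h1 : (Δ.toAddEnd ^ p) (X ^ (j + 1)) =
      X * (Δ.toAddEnd ^ p) (X ^ j) + Δ^[p] X * X ^ j := by
    have := DFunLike.congr_fun hleib (X ^ j)
    rw [pow_succ']
    exact this
  -- At X = 0 the right side dies because j > 0. On the left only the summand i = j survives, with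
  -- factor (j + 1)!, which is invertible because j + 1 < p.
  have h2 := congrArg (eval 0) h1
  rw [eval_add, eval_mul, eval_mul, eval_pow, eval_X, zero_mul, zero_pow h0.ne', mul_zero,
    add_zero, hsum] at h2
  have h3 : ∀ i, eval 0 ((polynomialMul A (hochschildCoeff D a (p - 1) i) * x ^ (i + 1))
      (X ^ (j + 1))) =
      if i = j then hochschildCoeff D a (p - 1) j * ((j + 1).factorial : A) else 0 := by
    intro i
    rw [AddMonoid.End.mul_apply_eq, polynomialMul_apply, polynomialExtend_pow_X_pow]
    split_ifs with h
    · subst h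
      have : (i + 1).descFactorial (i + 1) = (i + 1).factorial := Nat.descFactorial_self _
      simp [this, -Nat.descFactorial_succ]
    · rcases lt_or_gt_of_ne h with h | h
      · simp [zero_pow (by omega : j - i ≠ 0)]
      · rw [Nat.descFactorial_of_lt (by omega : j + 1 < i + 1)]; simp
  rw [AddMonoid.End.sum_apply, eval_finsetSum, Finset.sum_congr rfl fun i _ => h3 i,
    Finset.sum_ite_eq' , if_pos (Finset.mem_range.2 (by omega))] at h2
  have hu : IsUnit (((j + 1).factorial : ℕ) : A) := isUnit_natCast_of_coprime hA
    ((Nat.Prime.coprime_iff_not_dvd Fact.out).2 fun hd => by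
      have := (Nat.Prime.dvd_factorial Fact.out).1 hd
      omega).symm
  exact (hu.mul_left_eq_zero).1 h2

variable {D : Derivation k A A} {R : Type*} [Ring R] {ι : A →+* R} {x : R}

/-- Hochschild's formula. -/
theorem mul_pow_prime_sub_one_mul (hA : (p : A) = 0) (hp : 3 ≤ p)
    (hx : ∀ b, x * ι b = ι b * x + ι (D b)) (a : A) :
    (ι a * x) ^ (p - 1) * ι a =
      ι (a ^ p) * x ^ (p - 1) + ι ((fun b => a * D b)^[p - 1] a) := by
  have hp1 : p - 1 + 1 = p := by omega
  rw [mul_pow_mul_eq_sum a hx, Finset.sum_range_succ, hochschildCoeff_self, hp1,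
    Finset.sum_eq_single 0, hochschildCoeff_zero, pow_zero, mul_one, add_comm]
  · intro j hj h0
    rw [hochschildCoeff_prime_sub_one hA D a (Nat.pos_of_ne_zero h0) (Finset.mem_range.1 hj),
      map_zero, zero_mul]
  · intro h; exact absurd (Finset.mem_range.2 (by omega)) h

theorem mul_pow_prime (hA : (p : A) = 0) (hp : 3 ≤ p)
    (hx : ∀ b, x * ι b = ι b * x + ι (D b)) (a : A) :
    (ι a * x) ^ p = ι (a ^ p) * x ^ p + ι ((fun b => a * D b)^[p - 1] a) * x := by
  obtain ⟨q, rfl⟩ : ∃ q, p = q + 1 := ⟨p - 1, by omega⟩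
  have h := mul_pow_prime_sub_one_mul hA hp hx a
  simp only [Nat.add_sub_cancel] at h ⊢
  rw [pow_succ, ← mul_assoc, h, add_mul, mul_assoc, ← pow_succ]

end PolynomialExtension

/-! ### Iterated scalars and derivatives of Hochschild's formula. -/

section HochschildIdentities

variable {k A : Type*} [CommRing k] [CommRing A] [Algebra k A] {p : ℕ} [Fact p.Prime]

/-- Comparison of Hochschild's formula for `(a b) D` and for `a (b D)`. -/
theorem iterate_mul_derivation_mul (hA : (p : A) = 0) (hp : 3 ≤ p) (D : Derivation k A A)
    (a b : A) :
    (fun c => a * b * D c)^[p - 1] (a * b) =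
      a ^ p * (fun c => b * D c)^[p - 1] b + (fun c => a * b * D c)^[p - 1] a * b := by
  have hx := polynomialExtend_mul D
  set x := D.polynomialExtend.toAddEnd
  have hbx : ∀ c, polynomialMul A b * x * polynomialMul A c =
      polynomialMul A c * (polynomialMul A b * x) + polynomialMul A ((b • D) c) := by
    intro c
    rw [mul_assoc, hx, mul_add, ← mul_assoc, ← mul_assoc, ← map_mul, ← map_mul, mul_comm b c,
      ← map_mul]
    rfl
  have h1 := mul_pow_prime hA hp hx (a * b)
  have h2 := mul_pow_prime hA hp hx b
  have h3 := mul_pow_prime hA hp hbx a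
  have hX : x X = 1 := D.polynomialExtend_X
  have hfun : (fun c => a * (b • D) c) = fun c => a * b * D c := by
    ext c; simp [mul_assoc]
  rw [h2, ← mul_assoc, ← map_mul, h1, hfun] at h3
  -- Since `x` sends X to 1, applying both expansions to X isolates the coefficients of `x`; the
  -- terms in `x ^ p` agree because (ab)^p = a^p b^p.
  have h4 := DFunLike.congr_fun h3 X
  change C ((a * b) ^ p) * (x ^ p) X + C _ * x X = C (a ^ p) * (C (b ^ p) * (x ^ p) X + C _ * x X) +
    C _ * (C b * x X) at h4
  rw [hX, mul_pow, map_mul] at h4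
  have h5 : C ((fun c => a * b * D c)^[p - 1] (a * b)) = C (a ^ p * (fun c => b * D c)^[p - 1] b +
      (fun c => a * b * D c)^[p - 1] a * b) := by
    rw [map_add, map_mul, map_mul]
    linear_combination h4
  exact C_injective h5

/-- The symbols of the iterates of `V ↦ a [W, V]`, where `W` has symbol `D`, `V` has symbol `v`. -/
def iterateSymbol (D : Derivation k A A) (a : A) (v : A → A) : ℕ → A → A
  | 0 => fun b => a * v b
  | n + 1 => fun b => a * (D (iterateSymbol D a v n b) - iterateSymbol D a v n (D b))

/-- The coefficient of `W` in the `n`-fold bracket of `a W` with `a V + c W`. -/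
def iterateCorrection (D : Derivation k A A) (a : A) (v : A → A) (c : A) : ℕ → A
  | 0 => c
  | n + 1 => a * D (iterateCorrection D a v c n) - iterateCorrection D a v c n * D a -
      iterateSymbol D a v n a

section Iterate

variable {M : Type*} [LieRing M] [Module A M] {D : Derivation k A A} {W V : M} {v : A → A}

/-- Only brackets with multiples of one element `W` are assumed to obey a Leibniz rule. This covers
both a Lie–Rinehart algebra and an operator ring with its commutator, the latter having no anchor on
all its elements. -/
theorem lie_smul_of_symbol
    (hW : ∀ (b c : A) (Z : M), ⁅b • W, c • Z⁆ = c • ⁅b • W, Z⁆ + (b * D c) • Z)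
    {U : M} {u : A → A} (hU : ∀ b, ⁅U, b • W⁆ = b • ⁅U, W⁆ + u b • W) (a b : A) :
    ⁅a • U, b • W⁆ = b • ⁅a • U, W⁆ + (a * u b) • W := by
  have h1 := hW 1 a U
  rw [one_smul, one_mul] at h1
  rw [← lie_skew, hW, ← lie_skew, hU, ← lie_skew (a • U), h1, ← lie_skew W U]
  module

theorem lie_iterate_symbol
    (hW : ∀ (b c : A) (Z : M), ⁅b • W, c • Z⁆ = c • ⁅b • W, Z⁆ + (b * D c) • Z)
    (hV : ∀ b, ⁅V, b • W⁆ = b • ⁅V, W⁆ + v b • W) (a : A) (n : ℕ) (b : A) :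
    ⁅((Module.toAddMonoidEnd A M a * lieEnd M W) ^ n) (a • V), b • W⁆ =
      b • ⁅((Module.toAddMonoidEnd A M a * lieEnd M W) ^ n) (a • V), W⁆ +
        iterateSymbol D a v n b • W := by
  have hW1 : ∀ (c : A) (Z : M), ⁅W, c • Z⁆ = c • ⁅W, Z⁆ + D c • Z := by
    intro c Z
    have := hW 1 c Z
    rwa [one_smul, one_mul] at this
  induction n generalizing b with
  | zero => exact lie_smul_of_symbol hW hV a b
  | succ n ih =>
    rw [pow_succ', AddMonoid.End.mul_apply_eq]
    set Z := ((Module.toAddMonoidEnd A M a * lieEnd M W) ^ n) (a • V)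
    refine lie_smul_of_symbol (U := ⁅W, Z⁆)
      (u := fun b => D (iterateSymbol D a v n b) - iterateSymbol D a v n (D b)) hW (fun b => ?_) a b
    simp only [lie_lie, ih, lie_add, hW1, lie_self, smul_zero, zero_add, lie_zero]
    module

/-- Bracketing with `a • W` differs from `a` times bracketing with `W` by a multiple of `W`, the
multiple being the symbol evaluated at `a`. All errors therefore collect in a single coefficient of
`W`, which depends only on `a`, `c`, `D` and `v`. -/
theorem lieEnd_smul_pow_apply
    (hW : ∀ (b c : A) (Z : M), ⁅b • W, c • Z⁆ = c • ⁅b • W, Z⁆ + (b * D c) • Z)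
    (hV : ∀ b, ⁅V, b • W⁆ = b • ⁅V, W⁆ + v b • W) (a c : A) (n : ℕ) :
    (lieEnd M (a • W) ^ n) (a • V + c • W) =
      ((Module.toAddMonoidEnd A M a * lieEnd M W) ^ n) (a • V) +
        iterateCorrection D a v c n • W := by
  induction n with
  | zero => rfl
  | succ n ih =>
    have hs := lie_iterate_symbol hW hV a n a
    rw [pow_succ', AddMonoid.End.mul_apply_eq, ih, pow_succ', AddMonoid.End.mul_apply_eq,
      AddMonoid.End.mul_apply_eq]
    set Z := ((Module.toAddMonoidEnd A M a * lieEnd M W) ^ n) (a • V)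
    have h1 := hW 1 a W
    rw [one_smul, one_mul, lie_self, smul_zero, zero_add] at h1
    rw [lieEnd_apply, lie_add, hW, ← lie_skew, hs, ← lie_skew (a • W) W, h1, ← lie_skew Z W]
    change _ = a • ⁅W, Z⁆ + (a * D (iterateCorrection D a v c n) -
      iterateCorrection D a v c n * D a - iterateSymbol D a v n a) • W
    module

theorem lieEnd_smul_pow_prime_sub_one_apply (hA : (p : A) = 0) (hp : 3 ≤ p)
    (hW : ∀ (b c : A) (Z : M), ⁅b • W, c • Z⁆ = c • ⁅b • W, Z⁆ + (b * D c) • Z)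
    (hV : ∀ b, ⁅V, b • W⁆ = b • ⁅V, W⁆ + v b • W) (a c : A) :
    (lieEnd M (a • W) ^ (p - 1)) (a • V + c • W) =
      a ^ p • (lieEnd M W ^ (p - 1)) V + (fun b => a * D b)^[p - 1] a • V +
        iterateCorrection D a v c (p - 1) • W := by
  rw [lieEnd_smul_pow_apply hW hV]
  congr 1
  have hx : ∀ b, lieEnd M W * Module.toAddMonoidEnd A M b =
      Module.toAddMonoidEnd A M b * lieEnd M W + Module.toAddMonoidEnd A M (D b) := by
    intro b
    ext Z
    have := hW 1 b Z
    rwa [one_smul, one_mul] at this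
  exact DFunLike.congr_fun (mul_pow_prime_sub_one_mul hA hp hx a) V

end Iterate

attribute [local instance] LieRing.ofAssociativeRing

/-- The correction coefficient is a universal expression, so it can be computed where p-th powers
exist. In an associative ring the p-th power of `ι a * x` is known from Hochschild's formula, and
its commutator with `y` can be compared with the general expansion. -/
theorem map_iterateCorrection_mul (hA : (p : A) = 0) (hp : 3 ≤ p) {D θ : Derivation k A A}
    {R : Type*} [Ring R] (hR : (p : R) = 0) {ι : A →+* R} {x y : R}
    (hx : ∀ b, x * ι b = ι b * x + ι (D b)) (hy : ∀ b, y * ι b = ι b * y + ι (θ b)) (a : A) :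
    ι (iterateCorrection D a (fun b => θ (D b) - D (θ b)) (θ a) (p - 1)) * x =
      ι (θ ((fun b => a * D b)^[p - 1] a)) * x := by
  obtain ⟨q, rfl⟩ : ∃ q, p = q + 1 := ⟨p - 1, by omega⟩
  let _ : Module A R := Module.compHom R ι
  have hsmul : ∀ (b : A) (Z : R), b • Z = ι b * Z := fun _ _ => rfl
  have hW : ∀ (b c : A) (Z : R), ⁅b • x, c • Z⁆ = c • ⁅b • x, Z⁆ + (b * D c) • Z := by
    intro b c Z
    simp only [hsmul, Ring.lie_def, map_mul]
    have : ι b * x * (ι c * Z) = ι c * ι b * x * Z + ι b * ι (D c) * Z := by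
      rw [← map_mul ι c b, mul_comm c b, map_mul, mul_assoc, ← mul_assoc x, hx]; noncomm_ring
    rw [this]; noncomm_ring
  have hx1 : ∀ b, ⁅x, ι b⁆ = ι (D b) := fun b => by rw [Ring.lie_def, hx, add_sub_cancel_left]
  have hyι : ∀ b (Z : R), ⁅y, b • Z⁆ = b • ⁅y, Z⁆ + θ b • Z := by
    intro b Z
    simp only [hsmul, Ring.lie_def]
    rw [← mul_assoc, hy]; noncomm_ring
  have hy1 : ∀ b, ⁅y, ι b⁆ = ι (θ b) := fun b => by rw [Ring.lie_def, hy, add_sub_cancel_left]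
  have hV : ∀ b, ⁅⁅y, x⁆, b • x⁆ = b • ⁅⁅y, x⁆, x⁆ + (θ (D b) - D (θ b)) • x := by
    intro b
    have h1 : ⁅⁅y, x⁆, ι b⁆ = ι (θ (D b) - D (θ b)) := by
      rw [lie_lie, hx1, hy1, hy1, hx1, map_sub]
    rw [hsmul, hsmul, hsmul, ← h1]
    simp only [Ring.lie_def]; noncomm_ring
  -- Because [y, z] = -ad_z(y), one further adjoint power completes ad_z^p, which is the adjoint map
  -- of z^p.
  have hpow : ∀ z : R, (lieEnd R z ^ q) ⁅y, z⁆ = ⁅y, z ^ (q + 1)⁆ := by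
    intro z
    rw [← lie_skew, map_neg, ← lieEnd_apply (M := R), ← AddMonoid.End.mul_apply_eq, ← pow_succ,
      lieEnd_pow_prime hR, lieEnd_apply, lie_skew]
  have hθ : θ (a ^ (q + 1)) = 0 := by
    rw [θ.leibniz_pow, ← Nat.cast_smul_eq_nsmul A, hA, zero_smul]
  -- The starting vector a[y, x] + θ(a)x is [y, ax], so both adjoint powers turn into commutators of
  -- `y` with p-th powers.
  have key := lieEnd_smul_pow_prime_sub_one_apply hA hp hW hV a (θ a)
  rw [← hyι, Nat.add_sub_cancel, hpow, hpow, hsmul a x, mul_pow_prime hA hp hx, lie_add, ← hsmul,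
    ← hsmul, hyι, hyι, hθ, zero_smul, add_zero, ← add_assoc] at key
  exact (add_left_cancel key).symm

/-- The operator identity is realised on A[X], with `D` extended by X ↦ 1 and `θ` acting on
coefficients, and is read off at X. -/
theorem iterateCorrection_prime_sub_one (hA : (p : A) = 0) (hp : 3 ≤ p) (D θ : Derivation k A A)
    (a : A) :
    iterateCorrection D a (fun b => θ (D b) - D (θ b)) (θ a) (p - 1) =
      θ ((fun b => a * D b)^[p - 1] a) := by
  have h := DFunLike.congr_fun (map_iterateCorrection_mul hA hp
    (natCast_addEnd_eq_zero (A := A) hA) (polynomialExtend_mul D) (polynomialCoeff_mul θ) a) X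
  change C _ * D.polynomialExtend X = C _ * D.polynomialExtend X at h
  rw [D.polynomialExtend_X, mul_one, mul_one] at h
  exact C_injective h

end HochschildIdentities

/-! ### Differentiated Hochschild formula in a Lie–Rinehart algebra. -/

section LieRinehart

variable {k A L : Type*} [CommRing k] [CommRing A] [Algebra k A] [LieRing L] [LieAlgebra k L]
  [Module A L] [LieRingModule L A] [LieRinehartRing A L] [LieRinehartAlgebra k A L]
  {p : ℕ} [Fact p.Prime]

/-- `(a X) ^ (p - 1) (a)`, computed in `A` through the anchor. -/
def anchorPow (p : ℕ) (a : A) (X : L) : A := (fun b => a * ⁅X, b⁆)^[p - 1] a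

theorem LieRinehartRing.smul_lie_smul (W Z : L) (b c : A) :
    ⁅b • W, c • Z⁆ = c • ⁅b • W, Z⁆ + (b * ⁅W, c⁆) • Z := by simp

/-- Hochschild's formula, differentiated. -/
theorem lieEnd_smul_pow_derivation (hA : (p : A) = 0) (hp : 3 ≤ p) (θ : Derivation k A A)
    (θL : L →+ L) (hsmul : ∀ (b : A) (X : L), θL (b • X) = b • θL X + θ b • X)
    (hanchor : ∀ (X : L) (b : A), θ ⁅X, b⁆ = ⁅θL X, b⁆ + ⁅X, θ b⁆) (a : A) (W : L) :
    (lieEnd L (a • W) ^ (p - 1)) (θL (a • W)) =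
      a ^ p • (lieEnd L W ^ (p - 1)) (θL W) + θL (anchorPow p a W • W) := by
  let D := LieRinehartAlgebra.anchor k A L W
  have hV : ∀ b, ⁅θL W, b • W⁆ = b • ⁅θL W, W⁆ + (θ (D b) - D (θ b)) • W := by
    intro b
    rw [LieRinehartRing.leibniz_smul_right]
    change _ = _ + (θ ⁅W, b⁆ - ⁅W, θ b⁆) • W
    rw [hanchor, add_sub_cancel_right]
  have := lieEnd_smul_pow_prime_sub_one_apply (D := D) hA hp
    (fun b c Z => LieRinehartRing.smul_lie_smul W Z b c) hV a (θ a)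
  rw [hsmul, this, iterateCorrection_prime_sub_one hA hp, hsmul, add_assoc]
  rfl

end LieRinehart

/-! ### Jacobson's formula and its derivative. -/

section Jacobson

attribute [local instance] LieRing.ofAssociativeRing

variable {k : Type*} [Field k] {p : ℕ}

theorem LieHom.map_jacobsonCoeff {L L' : Type*} [LieRing L] [LieAlgebra k L] [LieRing L']
    [LieAlgebra k L'] (f : L →ₗ⁅k⁆ L') (x y : L) (n j : ℕ) :
    f (jacobsonCoeff x y n j) = jacobsonCoeff (f x) (f y) n j := by
  induction n generalizing j with
  | zero => cases j <;> simp [jacobsonCoeff]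
  | succ n ih => cases j <;> simp [jacobsonCoeff, ih]

theorem LieHom.map_jacobsonSum {L L' : Type*} [LieRing L] [LieAlgebra k L] [LieRing L']
    [LieAlgebra k L'] (f : L →ₗ⁅k⁆ L') (x y : L) :
    f (jacobsonSum k p x y) = jacobsonSum k p (f x) (f y) := by
  simp [jacobsonSum, f.map_jacobsonCoeff]

section Associative

variable {R : Type*} [Ring R]

theorem coeff_lieEnd_pow_C (x y : R) (n j : ℕ) :
    ((lieEnd R[X] (C x * X + C y) ^ n) (C x)).coeff j = jacobsonCoeff x y n j := by
  induction n generalizing j with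
  | zero => cases j <;> simp [jacobsonCoeff, coeff_C]
  | succ n ih =>
    rw [pow_succ', AddMonoid.End.mul_apply_eq, lieEnd_apply, Ring.lie_def]
    set f := (lieEnd R[X] (C x * X + C y) ^ n) (C x)
    rw [add_mul, mul_add, mul_assoc, X_mul, ← mul_assoc, ← mul_assoc]
    cases j with
    | zero => simp [jacobsonCoeff, ih, Ring.lie_def]
    | succ j =>
      simp only [coeff_sub, coeff_add, coeff_mul_X, coeff_C_mul, coeff_mul_C, ih, jacobsonCoeff,
        Ring.lie_def]
      abel

/-- As an operator, d/dX has commutator with multiplication by W = xX + y equal to multiplication by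
x. Evaluating the identity ad_W^p = ad_{W^p} on d/dX, and then on the polynomial 1, gives the
derivative. -/
theorem derivative_linear_pow [Fact p.Prime] (hR : (p : R) = 0) (x y : R) :
    derivative ((C x * X + C y) ^ p) = (lieEnd R[X] (C x * X + C y) ^ (p - 1)) (C x) := by
  obtain ⟨q, rfl⟩ : ∃ q, p = q + 1 := ⟨p - 1, by have := (Fact.out : p.Prime).pos; omega⟩
  rw [Nat.add_sub_cancel]
  set W : R[X] := C x * X + C y
  have hE : ((q + 1 : ℕ) : AddMonoid.End R[X]) = 0 := by
    ext1 f
    rw [AddMonoid.End.natCast_apply, ← Nat.cast_smul_eq_nsmul R, hR, zero_smul]; rfl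
  let l : R[X] → AddMonoid.End R[X] := AddMonoidHom.mulLeft
  have hl : ∀ f g, l f * l g = l (f * g) := fun f g => by
    ext1 h; exact (mul_assoc _ _ _).symm
  have hlpow : ∀ n, l W ^ n = l (W ^ n) := by
    intro n
    induction n with
    | zero => ext1 f; rw [pow_zero, pow_zero]; exact (one_mul f).symm
    | succ n ih => rw [pow_succ', ih, hl, pow_succ']
  have hlie : ∀ f g, ⁅l f, l g⁆ = l ⁅f, g⁆ := fun f g => by
    rw [Ring.lie_def, Ring.lie_def, hl, hl]; ext1 h; exact (sub_mul _ _ _).symm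
  have hliepow : ∀ n f, (lieEnd _ (l W) ^ n) (l f) = l ((lieEnd _ W ^ n) f) := by
    intro n f
    induction n with
    | zero => rfl
    | succ n ih =>
      rw [pow_succ', AddMonoid.End.mul_apply_eq, ih, lieEnd_apply, hlie, pow_succ',
        AddMonoid.End.mul_apply_eq, lieEnd_apply]
  let d : AddMonoid.End R[X] := (derivative (R := R)).toAddMonoidHom
  have hd : ⁅d, l W⁆ = l (C x) := by
    ext1 f
    change derivative (W * f) - W * derivative f = C x * f
    rw [derivative_mul, add_sub_cancel_right]
    simp [W]
  have h := congrArg (fun g => g d) (lieEnd_pow_prime hE (l W))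
  rw [pow_succ, AddMonoid.End.mul_apply_eq, lieEnd_apply, ← lie_skew, hd, map_neg, hliepow, hlpow,
    lieEnd_apply, ← lie_skew _ d, neg_inj] at h
  have h1 := DFunLike.congr_fun h 1
  change _ * 1 = derivative (W ^ (q + 1) * 1) - W ^ (q + 1) * derivative 1 at h1
  rw [derivative_one, mul_zero, sub_zero, mul_one, mul_one] at h1
  exact h1.symm

/-- Jacobson's formula. -/
theorem add_pow_eq_jacobsonSum [Fact p.Prime] [CharP k p] [Algebra k R] (x y : R) :
    (x + y) ^ p = x ^ p + y ^ p + jacobsonSum k p x y := by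
  have hR : (p : R) = 0 := by
    rw [← map_natCast (algebraMap k R), CharP.cast_eq_zero, map_zero]
  have hp0 := (Fact.out : p.Prime).pos
  set W : R[X] := C x * X + C y with hWdef
  have hdeg : W.natDegree ≤ 1 := natDegree_linear_le
  have hev : (x + y) ^ p = (W ^ p).eval 1 := by
    -- Over a noncommutative ring evaluation need not be multiplicative; it is at 1, because 1 is
    -- central.
    let e : R[X] →+* R := eval₂RingHom' (RingHom.id R) 1 fun a => Commute.one_right _
    have he : ∀ f, e f = f.eval 1 := fun f => rfl
    rw [← he, map_pow, he, hWdef]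
    simp
  rw [hev, eval_eq_sum_range' (n := p + 1)
    (Nat.lt_succ_of_le (natDegree_pow_le_of_le p hdeg |>.trans (by simp)))]
  simp only [one_pow, mul_one]
  have htop : (W ^ p).coeff p = x ^ p := by
    have := coeff_pow_of_natDegree_le (m := p) hdeg
    rw [mul_one] at this
    rw [this]; simp [hWdef]
  have hbot : (W ^ p).coeff 0 = y ^ p := by
    have := map_pow (constantCoeff (R := R)) W p
    simp only [constantCoeff_apply] at this
    rw [this]; simp [hWdef]
  -- The derivative determines i times the i-th coefficient, and i is invertible in k for 0 < i < p.
  have hmid : ∀ i ∈ Finset.Icc 1 (p - 1), (W ^ p).coeff i =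
      (i : k)⁻¹ • jacobsonCoeff x y (p - 1) (i - 1) := by
    intro i hi
    rw [Finset.mem_Icc] at hi
    obtain ⟨j, rfl⟩ : ∃ j, i = j + 1 := ⟨i - 1, by omega⟩
    have hne : ((j + 1 : ℕ) : k) ≠ 0 := by
      rw [Ne, CharP.cast_eq_zero_iff k p]
      exact Nat.not_dvd_of_pos_of_lt (by omega) (by omega)
    rw [Nat.add_sub_cancel, ← coeff_lieEnd_pow_C, ← derivative_linear_pow hR, coeff_derivative,
      eq_inv_smul_iff₀ hne, Nat.cast_smul_eq_nsmul, nsmul_eq_mul, ← Nat.cast_succ]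
    exact Nat.cast_commute _ _
  have hrange : Finset.range p = insert 0 (Finset.Icc 1 (p - 1)) := by
    ext i; simp only [Finset.mem_range, Finset.mem_insert, Finset.mem_Icc]; omega
  rw [Finset.sum_range_succ, htop, hrange, Finset.sum_insert (by simp), hbot,
    Finset.sum_congr rfl hmid, jacobsonSum]
  abel

end Associative

variable [Fact p.Prime] [CharP k p]

/-- Jacobson's formula for a representation of a Lie algebra. -/
theorem LieHom.add_pow_eq {L M : Type*} [LieRing L] [LieAlgebra k L] [AddCommGroup M] [Module k M]
    (ρ : L →ₗ⁅k⁆ Module.End k M) (X Y : L) :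
    ρ (X + Y) ^ p = ρ X ^ p + ρ Y ^ p + ρ (jacobsonSum k p X Y) := by
  rw [ρ.map_jacobsonSum, map_add]
  exact add_pow_eq_jacobsonSum _ _

variable {L : Type*} [LieRing L] [LieAlgebra k L]

/-- The action of `L` on `L × k` determined by a derivation `θ` of `L`, seen as the adjoint action
on the semidirect product of `L` with `k θ`. -/
def derivationRep (θ : L →ₗ[k] L) (hθ : ∀ X Y, θ ⁅X, Y⁆ = ⁅θ X, Y⁆ + ⁅X, θ Y⁆) :
    L →ₗ⁅k⁆ Module.End k (L × k) where
  toFun X := (LieAlgebra.ad k L X ∘ₗ LinearMap.fst k L k -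
    LinearMap.toSpanSingleton k L (θ X) ∘ₗ LinearMap.snd k L k).prod 0
  map_add' X Y := by
    refine LinearMap.ext fun v => Prod.ext ?_ ?_
    · simp; abel
    · simp
  map_smul' c X := by
    refine LinearMap.ext fun v => Prod.ext ?_ ?_
    · simp [smul_sub, smul_comm c]
    · simp
  map_lie' {X Y} := by
    refine LinearMap.ext fun v => Prod.ext ?_ ?_
    · simp only [LieRing.of_associative_ring_bracket, hθ, lie_lie, LinearMap.prod_apply,
        LinearMap.sub_apply, LinearMap.comp_apply, LinearMap.fst_apply, LinearMap.snd_apply,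
        LieAlgebra.ad_apply, LinearMap.toSpanSingleton_apply, Module.End.mul_apply,
        Function.prod_apply, LinearMap.zero_apply, zero_smul, sub_zero, lie_sub, lie_smul,
        Prod.fst_sub]
      rw [← lie_skew (θ X) Y]; module
    · simp [LieRing.of_associative_ring_bracket]

/-- The derivation `θ` applied to the formal `p`-th power of `X`. -/
def derivationPow (p : ℕ) (θ : L → L) (X : L) : L := (lieEnd L X ^ (p - 1)) (θ X)

/-- In the semidirect product with kθ, the p-th power of ad_Z sends θ to -ad_Z^{p-1}(θ Z).
Jacobson's formula for this representation, applied to the vector (0, 1) that stands for θ, is the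
claim. -/
theorem derivation_jacobsonSum (θ : L →ₗ[k] L) (hθ : ∀ X Y, θ ⁅X, Y⁆ = ⁅θ X, Y⁆ + ⁅X, θ Y⁆)
    (X Y : L) : θ (jacobsonSum k p X Y) =
      derivationPow p θ (X + Y) - derivationPow p θ X - derivationPow p θ Y := by
  obtain ⟨q, rfl⟩ : ∃ q, p = q + 1 := ⟨p - 1, by have := (Fact.out : p.Prime).pos; omega⟩
  let ρ := derivationRep θ hθ
  have h1 : ∀ Z, ρ Z (0, 1) = (-θ Z, 0) := fun Z => by simp [ρ, derivationRep]
  have h2 : ∀ Z (n : ℕ) (V : L), (ρ Z ^ n) (V, 0) = ((lieEnd L Z ^ n) V, 0) := by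
    intro Z n V
    induction n with
    | zero => rfl
    | succ n ih =>
      rw [pow_succ', Module.End.mul_apply, ih, pow_succ', AddMonoid.End.mul_apply_eq]
      simp [ρ, derivationRep]
  have h3 : ∀ Z, (ρ Z ^ (q + 1)) (0, 1) = (-derivationPow (q + 1) θ Z, 0) := fun Z => by
    rw [pow_succ, Module.End.mul_apply, h1, h2, map_neg]; rfl
  have h := LinearMap.congr_fun (ρ.add_pow_eq (p := q + 1) X Y) (0, 1)
  rw [LinearMap.add_apply, LinearMap.add_apply, h3, h3, h3, h1] at h
  have h4 := congrArg Prod.fst h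
  simp only [Prod.mk_add_mk] at h4
  rw [← neg_inj, ← sub_eq_zero] at h4 ⊢
  rw [← h4]; abel

end Jacobson

/-! ### Extension of scalars of Lie–Rinehart algebras -/

section ExtendScalars

variable {k B A L : Type*} [Field k] [CommRing B] [Algebra k B] [CommRing A] [Algebra k A]
  [LieRing L] [LieAlgebra k L] [Module A L] [LieRingModule L A] [LieRinehartRing A L]
  [LieRinehartAlgebra k A L]

variable (k B A L) in
/-- The action of `B ⊗ A` on `B ⊗ L`. -/
def extendScalarsSMul : B ⊗[k] A →ₗ[k] B ⊗[k] L →ₗ[k] B ⊗[k] L :=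
  TensorProduct.map₂ (LinearMap.mul k B) (Algebra.lsmul k k L : A →ₐ[k] Module.End k L).toLinearMap

theorem extendScalarsSMul_tmul (b b' : B) (a : A) (x : L) :
    extendScalarsSMul k B A L (b ⊗ₜ a) (b' ⊗ₜ x) = (b * b') ⊗ₜ (a • x) := rfl

instance instModuleExtendScalars : Module (B ⊗[k] A) (B ⊗[k] L) where
  smul a x := extendScalarsSMul k B A L a x
  one_smul x := by
    induction x with
    | zero => exact map_zero _
    | add x y hx hy => exact (map_add _ _ _).trans (congrArg₂ _ hx hy)
    | tmul b x =>
      refine (extendScalarsSMul_tmul 1 b 1 x).trans ?_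
      rw [one_mul, one_smul]
  mul_smul a a' x := by
    change extendScalarsSMul k B A L (a * a') x =
      extendScalarsSMul k B A L a (extendScalarsSMul k B A L a' x)
    induction a with
    | zero => simp
    | add a b ha hb => rw [add_mul, map_add, LinearMap.add_apply, ha, hb, map_add]; rfl
    | tmul b a =>
      induction a' with
      | zero => simp
      | add a b ha hb => rw [mul_add, map_add, LinearMap.add_apply, ha, hb, map_add,
          LinearMap.add_apply, map_add]
      | tmul b' a' =>
        induction x with
        | zero => simp
        | add a b ha hb => rw [map_add, ha, hb, map_add, map_add]
        | tmul c x =>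
          rw [Algebra.TensorProduct.tmul_mul_tmul]
          simp only [extendScalarsSMul_tmul, mul_assoc, mul_smul]
  smul_zero a := map_zero _
  smul_add a x y := map_add _ _ _
  add_smul a b x := by
    change extendScalarsSMul k B A L (a + b) x = _
    rw [map_add]; rfl
  zero_smul x := by
    change extendScalarsSMul k B A L 0 x = _
    rw [map_zero]; rfl

theorem extendScalars_smul_def (a : B ⊗[k] A) (x : B ⊗[k] L) :
    a • x = extendScalarsSMul k B A L a x := rfl

theorem extendScalars_tmul_smul_tmul (b b' : B) (a : A) (x : L) :
    (b ⊗ₜ[k] a) • (b' ⊗ₜ[k] x) = (b * b') ⊗ₜ[k] (a • x) := rfl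

instance instLieRinehartRingExtendScalars : LieRinehartRing (B ⊗[k] A) (B ⊗[k] L) where
  lie_smul_eq_mul' a b x := by
    induction a with
    | zero => simp
    | add a a' h h' => rw [add_smul, add_lie, h, h', add_mul]
    | tmul c a =>
      induction x with
      | zero => simp
      | add x y h h' => rw [smul_add, add_lie, h, h', add_lie, mul_add]
      | tmul d x =>
        induction b with
        | zero => simp
        | add b b' h h' => rw [lie_add, h, h', lie_add, mul_add]
        | tmul e b =>
          rw [extendScalars_tmul_smul_tmul, LieAlgebra.ExtendScalars.bracket_tmul,
            LieAlgebra.ExtendScalars.bracket_tmul, Algebra.TensorProduct.tmul_mul_tmul,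
            LieRinehartRing.lie_smul_eq_mul, mul_assoc]
  leibniz_mul_right' x a b := by
    induction x with
    | zero => simp
    | add x y h h' => rw [add_lie, h, h', add_lie, add_lie, smul_add, add_mul]; abel
    | tmul d x =>
      induction a with
      | zero => simp
      | add a a' h h' => rw [add_mul, lie_add, h, h', lie_add, add_smul, add_mul]; abel
      | tmul c a =>
        induction b with
        | zero => simp
        | add b b' h h' => rw [mul_add, lie_add, h, h', lie_add, smul_add, mul_add]; abel
        | tmul e b =>
          rw [Algebra.TensorProduct.tmul_mul_tmul, LieAlgebra.ExtendScalars.bracket_tmul,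
            LieAlgebra.ExtendScalars.bracket_tmul, LieAlgebra.ExtendScalars.bracket_tmul,
            smul_eq_mul, Algebra.TensorProduct.tmul_mul_tmul, Algebra.TensorProduct.tmul_mul_tmul,
            LieRinehartRing.leibniz_mul_right, TensorProduct.tmul_add, smul_eq_mul]
          congr 2 <;> ring
  leibniz_smul_right' x y a := by
    induction x with
    | zero => simp
    | add x y h h' => rw [add_lie, h, h', add_lie, add_lie, smul_add, add_smul]; abel
    | tmul d x =>
      induction a with
      | zero => simp
      | add a a' h h' => rw [add_smul, lie_add, h, h', lie_add, add_smul, add_smul]; abel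
      | tmul c a =>
        induction y with
        | zero => simp
        | add b b' h h' => rw [smul_add, lie_add, h, h', lie_add, smul_add, smul_add]; abel
        | tmul e b =>
          rw [extendScalars_tmul_smul_tmul, LieAlgebra.ExtendScalars.bracket_tmul,
            LieAlgebra.ExtendScalars.bracket_tmul, LieAlgebra.ExtendScalars.bracket_tmul,
            extendScalars_tmul_smul_tmul, extendScalars_tmul_smul_tmul,
            LieRinehartRing.leibniz_smul_right, TensorProduct.tmul_add]
          congr 2 <;> ring

instance instLieRinehartAlgebraExtendScalars :
    LieRinehartAlgebra k (B ⊗[k] A) (B ⊗[k] L) where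
  smul_assoc c a x := by
    rw [extendScalars_smul_def, map_smul]; rfl
  smul_lie c x a := by
    induction x with
    | zero => simp
    | add x y h h' => rw [smul_add, add_lie, h, h', add_lie, smul_add]
    | tmul d x =>
      induction a with
      | zero => simp
      | add a a' h h' => rw [lie_add, h, h', lie_add, smul_add]
      | tmul e a => rw [TensorProduct.smul_tmul', LieAlgebra.ExtendScalars.bracket_tmul,
          LieAlgebra.ExtendScalars.bracket_tmul, smul_mul_assoc, TensorProduct.smul_tmul']
  lie_smul c x a := by
    induction x with
    | zero => simp
    | add x y h h' => rw [add_lie, h, h', add_lie, smul_add]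
    | tmul d x =>
      induction a with
      | zero => simp
      | add a a' h h' => rw [smul_add, lie_add, h, h', lie_add, smul_add]
      | tmul e a => rw [TensorProduct.smul_tmul', LieAlgebra.ExtendScalars.bracket_tmul,
          LieAlgebra.ExtendScalars.bracket_tmul, mul_smul_comm, TensorProduct.smul_tmul']

variable (δ : Derivation k B B)

variable (A) in
/-- The derivation `δ ⊗ id` of `B ⊗ A`. -/
def Derivation.extendScalars : Derivation k (B ⊗[k] A) (B ⊗[k] A) :=
  Derivation.mk' (LinearMap.rTensor A (δ : B →ₗ[k] B)) fun a b => by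
    induction a with
    | zero => simp
    | add a a' h h' => rw [add_mul, map_add, h, h', map_add, add_smul, smul_add]; abel
    | tmul c a =>
      induction b with
      | zero => simp
      | add b b' h h' => rw [mul_add, map_add, h, h', map_add, add_smul, smul_add]; abel
      | tmul e b =>
        simp only [Algebra.TensorProduct.tmul_mul_tmul, LinearMap.rTensor_tmul, smul_eq_mul,
          Derivation.coeFn_coe, Derivation.leibniz, TensorProduct.add_tmul]
        rw [mul_comm a b]

theorem Derivation.extendScalars_tmul (b : B) (a : A) :
    δ.extendScalars A (b ⊗ₜ a) = δ b ⊗ₜ a := rfl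

/-- This and the two compatibilities with the bracket and the anchor below make `δ ⊗ id` a
derivation of the pair (B ⊗ A, B ⊗ L), as the differentiated formulas require. -/
theorem rTensor_derivation_smul (a : B ⊗[k] A) (x : B ⊗[k] L) :
    LinearMap.rTensor L (δ : B →ₗ[k] B) (a • x) =
      a • LinearMap.rTensor L (δ : B →ₗ[k] B) x + δ.extendScalars A a • x := by
  induction a with
  | zero => simp
  | add a a' h h' => rw [add_smul, map_add, h, h', map_add, add_smul, add_smul]; abel
  | tmul c a =>
    induction x with
    | zero => simp
    | add b b' h h' => rw [smul_add, map_add, h, h', map_add, smul_add, smul_add]; abel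
    | tmul e b =>
      rw [Derivation.extendScalars_tmul]
      simp only [extendScalars_tmul_smul_tmul, LinearMap.rTensor_tmul,
        Derivation.coeFn_coe, Derivation.leibniz, TensorProduct.add_tmul, smul_eq_mul]
      rw [mul_comm e]

theorem rTensor_derivation_lie (x y : B ⊗[k] L) :
    LinearMap.rTensor L (δ : B →ₗ[k] B) ⁅x, y⁆ =
      ⁅LinearMap.rTensor L (δ : B →ₗ[k] B) x, y⁆ + ⁅x, LinearMap.rTensor L (δ : B →ₗ[k] B) y⁆ := by
  induction x with
  | zero => simp
  | add a a' h h' => rw [add_lie, map_add, h, h', map_add, add_lie, add_lie]; abel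
  | tmul c a =>
    induction y with
    | zero => simp
    | add b b' h h' => rw [lie_add, map_add, h, h', map_add, lie_add, lie_add]; abel
    | tmul e b =>
      simp only [LieAlgebra.ExtendScalars.bracket_tmul, LinearMap.rTensor_tmul,
        Derivation.coeFn_coe, Derivation.leibniz, TensorProduct.add_tmul, smul_eq_mul]
      rw [mul_comm e, add_comm]

theorem extendScalars_derivation_lie (x : B ⊗[k] L) (a : B ⊗[k] A) :
    δ.extendScalars A ⁅x, a⁆ =
      ⁅LinearMap.rTensor L (δ : B →ₗ[k] B) x, a⁆ + ⁅x, δ.extendScalars A a⁆ := by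
  induction x with
  | zero => simp
  | add a a' h h' => rw [add_lie, map_add, h, h', map_add, add_lie, add_lie]; abel
  | tmul c x =>
    induction a with
    | zero => simp
    | add b b' h h' => rw [lie_add, map_add, h, h', map_add, lie_add, lie_add]; abel
    | tmul e b =>
      rw [Derivation.extendScalars_tmul]
      simp only [LieAlgebra.ExtendScalars.bracket_tmul, LinearMap.rTensor_tmul,
        Derivation.coeFn_coe, Derivation.leibniz, TensorProduct.add_tmul, smul_eq_mul,
        Derivation.extendScalars_tmul]
      rw [mul_comm e, add_comm]

end ExtendScalars

/-! ### Polynomial families -/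

section PolynomialValue

variable {k : Type*} [Field k]

/-- A multiplicative family of functionals on the steps of a filtration of an algebra. -/
structure IsFilteredPoint {B : Type*} [CommRing B] [Algebra k B] (F : ℕ → Submodule k B)
    (ε : ℕ → B →ₗ[k] k) : Prop where
  mul_mem : ∀ {m n : ℕ} {f g : B}, f ∈ F m → g ∈ F n → f * g ∈ F (m + n)
  map_mul : ∀ {m n : ℕ} {f g : B}, f ∈ F m → g ∈ F n → ε (m + n) (f * g) = ε m f * ε n g
  one_mem : 1 ∈ F 0
  map_one : ε 0 1 = 1

/-- The element `z` of `B ⊗ M` lies in the `n`-th step of the filtration induced by `F`, and its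
value at `ε` is `m`. -/
def HasFilteredValue {B M : Type*} [CommRing B] [Algebra k B] [AddCommGroup M] [Module k M]
    (F : ℕ → Submodule k B) (ε : ℕ → B →ₗ[k] k) (n : ℕ) (z : B ⊗[k] M) (m : M) : Prop :=
  z ∈ Submodule.span k {w | ∃ (f : B) (x : M), f ∈ F n ∧ f ⊗ₜ x = w} ∧
    TensorProduct.lid k M (LinearMap.rTensor M (ε n) z) = m

namespace HasFilteredValue

variable {B M N P : Type*} [CommRing B] [Algebra k B] [AddCommGroup M] [Module k M]
  [AddCommGroup N] [Module k N] [AddCommGroup P] [Module k P] {F : ℕ → Submodule k B}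
  {ε : ℕ → B →ₗ[k] k} {m n : ℕ} {z z' : B ⊗[k] M} {x x' : M} {w : B ⊗[k] N} {y : N}

theorem tmul {f : B} (hf : f ∈ F n) (x : M) : HasFilteredValue F ε n (f ⊗ₜ x) (ε n f • x) :=
  ⟨Submodule.subset_span ⟨f, x, hf, rfl⟩, by simp⟩

theorem zero : HasFilteredValue F ε n (0 : B ⊗[k] M) 0 := ⟨zero_mem _, by simp⟩

theorem add (h : HasFilteredValue F ε n z x) (h' : HasFilteredValue F ε n z' x') :
    HasFilteredValue F ε n (z + z') (x + x') :=
  ⟨add_mem h.1 h'.1, by rw [map_add, map_add, h.2, h'.2]⟩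

theorem sub (h : HasFilteredValue F ε n z x) (h' : HasFilteredValue F ε n z' x') :
    HasFilteredValue F ε n (z - z') (x - x') :=
  ⟨sub_mem h.1 h'.1, by rw [map_sub, map_sub, h.2, h'.2]⟩

theorem const_smul (c : k) (h : HasFilteredValue F ε n z x) :
    HasFilteredValue F ε n (c • z) (c • x) :=
  ⟨Submodule.smul_mem _ _ h.1, by rw [map_smul, map_smul, h.2]⟩

theorem sum {ι : Type*} {s : Finset ι} {z : ι → B ⊗[k] M} {x : ι → M}
    (h : ∀ i ∈ s, HasFilteredValue F ε n (z i) (x i)) :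
    HasFilteredValue F ε n (∑ i ∈ s, z i) (∑ i ∈ s, x i) :=
  ⟨sum_mem fun i hi => (h i hi).1, by
    rw [map_sum, map_sum]; exact Finset.sum_congr rfl fun i hi => (h i hi).2⟩

/-- The bracket, the anchor action, the product of `A` and the scalar action are all base changes of
k-bilinear maps, so this one statement controls degrees and values for each of them. -/
theorem map₂ (hε : IsFilteredPoint F ε) (β : M →ₗ[k] N →ₗ[k] P)
    (hz : HasFilteredValue F ε m z x) (hw : HasFilteredValue F ε n w y) :
    HasFilteredValue F ε (m + n) (TensorProduct.map₂ (LinearMap.mul k B) β z w) (β x y) := by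
  obtain ⟨hz, rfl⟩ := hz
  obtain ⟨hw, rfl⟩ := hw
  induction hz using Submodule.span_induction with
  | zero => simpa using zero
  | add a b _ _ ha hb => simpa using ha.add hb
  | smul c a _ ha => simpa using ha.const_smul c
  | mem a ha =>
    obtain ⟨f, x, hf, rfl⟩ := ha
    induction hw using Submodule.span_induction with
    | zero => simpa using zero
    | add a b _ _ ha hb => simpa using ha.add hb
    | smul c a _ ha => simpa using ha.const_smul c
    | mem a ha =>
      obtain ⟨g, y, hg, rfl⟩ := ha
      have := tmul (ε := ε) (hε.mul_mem hf hg) (β x y)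
      rw [hε.map_mul hf hg] at this
      simpa [mul_smul, smul_comm (ε n g)] using this

theorem congr_degree (h : HasFilteredValue F ε m z x) (hmn : m = n) :
    HasFilteredValue F ε n z x := hmn ▸ h

variable {L : Type*} [LieRing L] [LieAlgebra k L]

theorem lie [LieRingModule L N] [LieModule k L N] (hε : IsFilteredPoint F ε) {z : B ⊗[k] L}
    {x : L} (hz : HasFilteredValue F ε m z x) (hw : HasFilteredValue F ε n w y) :
    HasFilteredValue F ε (m + n) ⁅z, w⁆ ⁅x, y⁆ := by
  let β : L →ₗ[k] N →ₗ[k] N :=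
    LinearMap.mk₂ k (fun x m => ⁅x, m⁆) add_lie smul_lie lie_add fun c x m => lie_smul c x m
  suffices h : ⁅z, w⁆ = TensorProduct.map₂ (LinearMap.mul k B) β z w from h ▸ hz.map₂ hε β hw
  clear hz hw
  induction z with
  | zero => exact (zero_lie w).trans (by simp)
  | add a b ha hb => exact (add_lie a b w).trans (by rw [ha, hb]; simp)
  | tmul f x =>
    induction w with
    | zero => simp
    | add a b ha hb => rw [lie_add, ha, hb]; simp
    | tmul g y => rfl

section Jacobson

variable {z w : B ⊗[k] L} {x y : L}

theorem jacobsonCoeff (hε : IsFilteredPoint F ε) (hz : HasFilteredValue F ε 1 z x)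
    (hw : HasFilteredValue F ε 1 w y) (n j : ℕ) :
    HasFilteredValue F ε (n + 1) (jacobsonCoeff z w n j) (jacobsonCoeff x y n j) := by
  induction n generalizing j with
  | zero =>
    cases j with
    | zero => exact hz
    | succ j => exact zero
  | succ n ih =>
    cases j with
    | zero => exact (hw.lie hε (ih 0)).congr_degree (add_comm _ _)
    | succ j => exact ((hz.lie hε (ih j)).add (hw.lie hε (ih (j + 1)))).congr_degree (add_comm _ _)

theorem jacobsonSum (hε : IsFilteredPoint F ε) {p : ℕ} (hp : p ≠ 0)
    (hz : HasFilteredValue F ε 1 z x) (hw : HasFilteredValue F ε 1 w y) :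
    HasFilteredValue F ε p (jacobsonSum k p z w) (jacobsonSum k p x y) :=
  sum fun _ _ => ((hz.jacobsonCoeff hε hw _ _).congr_degree
    (Nat.sub_add_cancel (Nat.pos_of_ne_zero hp))).const_smul _

end Jacobson

variable {A : Type*} [CommRing A] [Algebra k A] [Module A L] [LieRingModule L A]
  [LieRinehartRing A L] [LieRinehartAlgebra k A L] {a : B ⊗[k] A} {b : A} {z : B ⊗[k] L}
  {x : L}

theorem mul (hε : IsFilteredPoint F ε) {a' : B ⊗[k] A} {b' : A}
    (ha : HasFilteredValue F ε m a b) (ha' : HasFilteredValue F ε n a' b') :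
    HasFilteredValue F ε (m + n) (a * a') (b * b') := by
  suffices h : a * a' = TensorProduct.map₂ (LinearMap.mul k B) (LinearMap.mul k A) a a' from
    h ▸ ha.map₂ hε (LinearMap.mul k A) ha'
  clear ha ha'
  induction a with
  | zero => simp
  | add a b ha hb => rw [add_mul, ha, hb]; simp
  | tmul f x =>
    induction a' with
    | zero => simp
    | add a b ha hb => rw [mul_add, ha, hb]; simp
    | tmul g y => exact Algebra.TensorProduct.tmul_mul_tmul _ _ _ _

theorem pow (hε : IsFilteredPoint F ε) (ha : HasFilteredValue F ε m a b) (n : ℕ) :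
    HasFilteredValue F ε (m * n) (a ^ n) (b ^ n) := by
  induction n with
  | zero => simpa [hε.map_one, Algebra.TensorProduct.one_def] using tmul (ε := ε) hε.one_mem (1 : A)
  | succ n ih => rw [pow_succ, pow_succ]; exact ih.mul hε ha

theorem smul (hε : IsFilteredPoint F ε) (ha : HasFilteredValue F ε m a b)
    (hz : HasFilteredValue F ε n z x) : HasFilteredValue F ε (m + n) (a • z) (b • x) :=
  ha.map₂ hε (Algebra.lsmul k k L : A →ₐ[k] Module.End k L).toLinearMap hz

theorem anchorPow (hε : IsFilteredPoint F ε) (ha : HasFilteredValue F ε m a b)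
    (hz : HasFilteredValue F ε n z x) (p : ℕ) :
    HasFilteredValue F ε ((p - 1) * (m + n) + m) (anchorPow p a z) (anchorPow p b x) := by
  have : ∀ q : ℕ, HasFilteredValue F ε (q * (m + n) + m) ((fun c => a * ⁅z, c⁆)^[q] a)
      ((fun c => b * ⁅x, c⁆)^[q] b) := by
    intro q
    induction q with
    | zero => simpa using ha
    | succ q ih =>
      rw [Function.iterate_succ_apply', Function.iterate_succ_apply']
      exact (ha.mul hε (hz.lie hε ih)).congr_degree (by ring)
  exact this _

end HasFilteredValue

theorem mul_mem_degreeLE {m n : ℕ} {f g : k[X]} (hf : f ∈ degreeLE k m) (hg : g ∈ degreeLE k n) :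
    f * g ∈ degreeLE k (m + n : ℕ) :=
  mem_degreeLE.2 ((degree_mul_le _ _).trans
    (add_le_add (mem_degreeLE.1 hf) (mem_degreeLE.1 hg)))

theorem isFilteredPoint_leval (c : k) :
    IsFilteredPoint (fun n : ℕ => degreeLE k n) fun _ => leval c where
  mul_mem := mul_mem_degreeLE
  map_mul _ _ := eval_mul
  one_mem := mem_degreeLE.2 degree_one_le
  map_one := eval_one

/-- This is the point at infinity: taking the coefficient of X^n is multiplicative only relative to
the degree bound n, which is why functionals are indexed by filtration steps. -/
theorem isFilteredPoint_lcoeff :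
    IsFilteredPoint (fun n : ℕ => degreeLE k n) fun n => lcoeff k n where
  mul_mem := mul_mem_degreeLE
  map_mul hf hg := coeff_mul_add_eq_of_natDegree_le
    (natDegree_le_of_degree_le (mem_degreeLE.1 hf)) (natDegree_le_of_degree_le (mem_degreeLE.1 hg))
  one_mem := mem_degreeLE.2 degree_one_le
  map_one := coeff_one_zero

/-- A polynomial of degree `≤ p` in characteristic `p` with zero derivative is determined by its
constant and leading coefficients. -/
theorem HasFilteredValue.eq_add_of_derivative_eq_zero {p : ℕ} [Fact p.Prime] [CharP k p]
    {M : Type*} [AddCommGroup M] [Module k M]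
    {z : k[X] ⊗[k] M}
    {x₁ x₀ x₂ : M} (h₁ : HasFilteredValue (fun n : ℕ => degreeLE k n) (fun _ => leval (1 : k)) p z x₁)
    (h₀ : HasFilteredValue (fun n : ℕ => degreeLE k n) (fun _ => leval (0 : k)) p z x₀)
    (h₂ : HasFilteredValue (fun n : ℕ => degreeLE k n) (fun n => lcoeff k n) p z x₂)
    (hd : LinearMap.rTensor M (derivative (R := k)) z = 0) : x₁ = x₀ + x₂ := by
  have hp0 := (Fact.out : p.Prime).pos
  have hf : ∀ f : k[X], f.natDegree ≤ p → f.eval 1 = f.eval 0 + f.coeff p +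
      ∑ i ∈ Finset.Icc 1 (p - 1), ((i : ℕ) : k)⁻¹ * (derivative f).coeff (i - 1) := by
    intro f hf
    have hrange : Finset.range p = insert 0 (Finset.Icc 1 (p - 1)) := by
      ext i; simp only [Finset.mem_range, Finset.mem_insert, Finset.mem_Icc]; omega
    rw [eval_eq_sum_range' (Nat.lt_succ_of_le hf)]
    simp only [one_pow, mul_one]
    rw [Finset.sum_range_succ, hrange, Finset.sum_insert (by simp), ← coeff_zero_eq_eval_zero,
      Finset.sum_congr rfl (g := fun i : ℕ => (i : k)⁻¹ * (derivative f).coeff (i - 1))]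
    · ring
    · intro i hi
      rw [Finset.mem_Icc] at hi
      obtain ⟨j, rfl⟩ : ∃ j, i = j + 1 := ⟨i - 1, by omega⟩
      have hne : ((j + 1 : ℕ) : k) ≠ 0 := by
        rw [Ne, CharP.cast_eq_zero_iff k p]
        exact Nat.not_dvd_of_pos_of_lt (by omega) (by omega)
      rw [Nat.add_sub_cancel, coeff_derivative, ← Nat.cast_succ, mul_comm, mul_assoc,
        mul_inv_cancel₀ hne, mul_one]
  -- Applied to f′, this functional returns the sum of the coefficients of f in degrees 1 to p - 1.
  -- The decomposition of f(1) thus becomes a linear identity, valid in `k[X] ⊗ M`.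
  let S : k[X] →ₗ[k] k := ∑ i ∈ Finset.Icc 1 (p - 1), ((i : ℕ) : k)⁻¹ • lcoeff k (i - 1)
  have key : TensorProduct.lid k M (LinearMap.rTensor M (leval (1 : k)) z) =
      TensorProduct.lid k M (LinearMap.rTensor M (leval (0 : k)) z) +
      TensorProduct.lid k M (LinearMap.rTensor M (lcoeff k p) z) +
      TensorProduct.lid k M (LinearMap.rTensor M S (LinearMap.rTensor M derivative z)) := by
    obtain ⟨hz, -⟩ := h₁
    clear hd h₀ h₂
    induction hz using Submodule.span_induction with
    | zero => simp
    | add a b _ _ ha hb => simp only [map_add, ha, hb]; abel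
    | smul c a _ ha => simp only [map_smul, ha, smul_add]
    | mem a ha =>
      obtain ⟨f, x, hfp, rfl⟩ := ha
      replace hfp := natDegree_le_of_degree_le (mem_degreeLE.1 hfp)
      simp only [LinearMap.rTensor_tmul, TensorProduct.lid_tmul, leval_apply, lcoeff_apply]
      rw [hf f hfp, add_smul, add_smul]
      congr 2
      simp [S, LinearMap.sum_apply]
  rw [hd, map_zero, map_zero, add_zero] at key
  rw [← h₁.2, key, h₀.2, h₂.2]

end PolynomialValue

/-! ### Identities between formal `p`-th powers -/

section JacobsonSum

variable {k L : Type*} [Field k] [LieRing L] [LieAlgebra k L] {p : ℕ}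

theorem jacobsonCoeff_zero_left (y : L) (n j : ℕ) : jacobsonCoeff 0 y n j = 0 := by
  induction n generalizing j with
  | zero => cases j <;> rfl
  | succ n ih => cases j <;> simp [jacobsonCoeff, ih]

theorem jacobsonCoeff_of_lie_eq_zero {x y : L} (h : ⁅y, x⁆ = 0) (n j : ℕ) :
    jacobsonCoeff x y (n + 1) j = 0 := by
  induction n generalizing j with
  | zero => rcases j with - | - | j <;> simp [jacobsonCoeff, h]
  | succ n ih => cases j <;> rw [jacobsonCoeff] <;> simp only [ih, lie_zero, add_zero]

@[simp] theorem jacobsonSum_zero_left (y : L) : jacobsonSum k p 0 y = 0 := by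
  simp [jacobsonSum, jacobsonCoeff_zero_left]

theorem jacobsonSum_of_lie_eq_zero {x y : L} (h : ⁅y, x⁆ = 0) : jacobsonSum k p x y = 0 := by
  refine Finset.sum_eq_zero fun i hi => ?_
  obtain ⟨q, hq⟩ : ∃ q, p - 1 = q + 1 := ⟨p - 2, by have := Finset.mem_Icc.1 hi; omega⟩
  rw [hq, jacobsonCoeff_of_lie_eq_zero h, smul_zero]

@[simp] theorem jacobsonSum_zero_right (x : L) : jacobsonSum k p x 0 = 0 :=
  jacobsonSum_of_lie_eq_zero (zero_lie x)

variable (k p) in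
/-- The failure of the symmetry of `jacobsonSum`. -/
def jacobsonCommDefect (x y : L) : L := jacobsonSum k p x y - jacobsonSum k p y x

variable (k p) in
/-- The failure of the cocycle identity for `jacobsonSum`. -/
def jacobsonCocycleDefect (x y z : L) : L :=
  jacobsonSum k p x y + jacobsonSum k p (x + y) z - jacobsonSum k p y z - jacobsonSum k p x (y + z)

variable {A : Type*} [CommRing A] [LieRingModule L A]

theorem anchorPow_of_lie_eq_zero (hp : 2 ≤ p) {a : A} {x : L} (h : ⁅x, a⁆ = 0) :
    anchorPow p a x = 0 := by
  obtain ⟨q, rfl⟩ : ∃ q, p = q + 1 + 1 := ⟨p - 2, by omega⟩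
  rw [anchorPow, Nat.add_sub_cancel, Function.iterate_succ_apply, h, mul_zero]
  exact Function.iterate_fixed (by rw [lie_zero, mul_zero]) q

variable [Module A L]

variable (k p) in
/-- The failure of the distributivity of scalars over sums for formal `p`-th powers. -/
def smulAddDefect (a : A) (x y : L) : L :=
  a ^ p • jacobsonSum k p x y + anchorPow p a (x + y) • (x + y) - anchorPow p a x • x -
    anchorPow p a y • y - jacobsonSum k p (a • x) (a • y)

variable (k p) in
/-- The failure of the distributivity of sums of scalars for formal `p`-th powers. -/
def addSmulDefect (a b : A) (x : L) : L :=
  anchorPow p (a + b) x • x - anchorPow p a x • x - anchorPow p b x • x -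
    jacobsonSum k p (a • x) (b • x)

end JacobsonSum

/-! ### Derivations annihilate the defects. -/

section Derivation

variable {k A L : Type*} [Field k] [CommRing A] [Algebra k A] [LieRing L] [LieAlgebra k L]
  [Module A L] [LieRingModule L A] [LieRinehartRing A L] [LieRinehartAlgebra k A L]
  {p : ℕ} [Fact p.Prime] [CharP k p] (θ : Derivation k A A) (θL : L →ₗ[k] L)

theorem natCast_prime_eq_zero (k A : Type*) [Field k] [CommRing A] [Algebra k A] (p : ℕ)
    [CharP k p] : (p : A) = 0 := by
  rw [← map_natCast (algebraMap k A), CharP.cast_eq_zero, map_zero]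

theorem add_pow_prime_of_algebra (k : Type*) {A : Type*} [Field k] [CommRing A] [Algebra k A] (p : ℕ)
    [Fact p.Prime] [CharP k p] (a b : A) : (a + b) ^ p = a ^ p + b ^ p := by
  obtain ⟨r, hr⟩ := exists_add_pow_prime_eq (Fact.out : p.Prime) a b
  rw [hr, natCast_prime_eq_zero k A p]; ring

variable (hlie : ∀ X Y, θL ⁅X, Y⁆ = ⁅θL X, Y⁆ + ⁅X, θL Y⁆)

-- With P(x) = `derivationPow p θL x`, the derivation sends the Jacobson sum of x and y to P(x + y)
-- - P(x) - P(y). This coboundary is symmetric, and for the same reason the cocycle defect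
-- telescopes.
include hlie in
theorem derivation_jacobsonCommDefect (x y : L) : θL (jacobsonCommDefect k p x y) = 0 := by
  rw [jacobsonCommDefect, map_sub, derivation_jacobsonSum θL hlie, derivation_jacobsonSum θL hlie,
    add_comm y x]
  abel

include hlie in
theorem derivation_jacobsonCocycleDefect (x y z : L) :
    θL (jacobsonCocycleDefect k p x y z) = 0 := by
  simp only [jacobsonCocycleDefect, map_sub, map_add, derivation_jacobsonSum θL hlie]
  rw [add_assoc x y z]
  abel

variable (hsmul : ∀ (b : A) (X : L), θL (b • X) = b • θL X + θ b • X)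
  (hanchor : ∀ (X : L) (b : A), θ ⁅X, b⁆ = ⁅θL X, b⁆ + ⁅X, θ b⁆)

-- Together with `derivation_jacobsonSum`, this turns every term of the scalar defects into values
-- of `derivationPow`, which then cancel in pairs.
include hsmul hanchor in
theorem derivation_anchorPow_smul (hp : 3 ≤ p) (a : A) (x : L) :
    θL (anchorPow p a x • x) = derivationPow p θL (a • x) - a ^ p • derivationPow p θL x := by
  rw [eq_sub_iff_add_eq, add_comm]
  exact (lieEnd_smul_pow_derivation (natCast_prime_eq_zero k A p) hp θ θL.toAddMonoidHom hsmul
    hanchor a x).symm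

omit [Fact p.Prime] in
theorem derivation_pow_prime (a : A) : θ (a ^ p) = 0 := by
  rw [θ.leibniz_pow, ← Nat.cast_smul_eq_nsmul A, natCast_prime_eq_zero k A p, zero_smul]

include hlie hsmul hanchor in
theorem derivation_smulAddDefect (hp : 3 ≤ p) (a : A) (x y : L) :
    θL (smulAddDefect k p a x y) = 0 := by
  simp only [smulAddDefect, map_sub, map_add, derivation_anchorPow_smul θ θL hsmul hanchor hp,
    derivation_jacobsonSum θL hlie]
  rw [hsmul, derivation_pow_prime θ, derivation_jacobsonSum θL hlie, smul_add a x y]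
  module

include hlie hsmul hanchor in
theorem derivation_addSmulDefect (hp : 3 ≤ p) (a b : A) (x : L) :
    θL (addSmulDefect k p a b x) = 0 := by
  have hab := add_pow_prime_of_algebra k p a b
  simp only [addSmulDefect, map_sub, derivation_anchorPow_smul θ θL hsmul hanchor hp,
    derivation_jacobsonSum θL hlie]
  rw [add_smul, hab]
  module

end Derivation

/-! ### Homogeneity of the defects in degree p. -/

namespace HasFilteredValue

variable {k B A L : Type*} [Field k] [CommRing B] [Algebra k B] {F : ℕ → Submodule k B}
  {ε : ℕ → B →ₗ[k] k} [CommRing A] [Algebra k A] [LieRing L] [LieAlgebra k L]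
  [Module A L] [LieRingModule L A] [LieRinehartRing A L] [LieRinehartAlgebra k A L]
  {p : ℕ} {u v w : B ⊗[k] L} {x y z : L} {r s : B ⊗[k] A} {a b : A}

theorem commDefect (hε : IsFilteredPoint F ε) (hp : p ≠ 0) (hu : HasFilteredValue F ε 1 u x)
    (hv : HasFilteredValue F ε 1 v y) :
    HasFilteredValue F ε p (jacobsonCommDefect k p u v) (jacobsonCommDefect k p x y) :=
  (hu.jacobsonSum hε hp hv).sub (hv.jacobsonSum hε hp hu)

theorem cocycleDefect (hε : IsFilteredPoint F ε) (hp : p ≠ 0) (hu : HasFilteredValue F ε 1 u x)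
    (hv : HasFilteredValue F ε 1 v y) (hw : HasFilteredValue F ε 1 w z) :
    HasFilteredValue F ε p (jacobsonCocycleDefect k p u v w) (jacobsonCocycleDefect k p x y z) :=
  (((hu.jacobsonSum hε hp hv).add ((hu.add hv).jacobsonSum hε hp hw)).sub
    (hv.jacobsonSum hε hp hw)).sub (hu.jacobsonSum hε hp (hv.add hw))

theorem smulAddDefect (hε : IsFilteredPoint F ε) (hp : p ≠ 0) (hr : HasFilteredValue F ε 0 r a)
    (hu : HasFilteredValue F ε 1 u x) (hv : HasFilteredValue F ε 1 v y) :
    HasFilteredValue F ε p (smulAddDefect k p r u v) (smulAddDefect k p a x y) := by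
  have h : ∀ {u : B ⊗[k] L} {x : L}, HasFilteredValue F ε 1 u x →
      HasFilteredValue F ε p (_root_.anchorPow p r u • u) (_root_.anchorPow p a x • x) := fun hu =>
    ((hr.anchorPow hε hu p).smul hε hu).congr_degree (by omega)
  have hs : ∀ {u : B ⊗[k] L} {x : L}, HasFilteredValue F ε 1 u x →
      HasFilteredValue F ε 1 (r • u) (a • x) := fun hu => (hr.smul hε hu).congr_degree (by omega)
  have h1 : HasFilteredValue F ε p (r ^ p • _root_.jacobsonSum k p u v)
      (a ^ p • _root_.jacobsonSum k p x y) :=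
    ((hr.pow hε p).smul hε (hu.jacobsonSum hε hp hv)).congr_degree (by omega)
  have h2 := (hs hu).jacobsonSum hε hp (hs hv)
  exact (((h1.add (h (hu.add hv))).sub (h hu)).sub (h hv)).sub h2

theorem addSmulDefect (hε : IsFilteredPoint F ε) (hp : p ≠ 0) (hr : HasFilteredValue F ε 1 r a)
    (hs : HasFilteredValue F ε 1 s b) (hu : HasFilteredValue F ε 0 u x) :
    HasFilteredValue F ε p (addSmulDefect k p r s u) (addSmulDefect k p a b x) := by
  have h : ∀ {r : B ⊗[k] A} {a : A}, HasFilteredValue F ε 1 r a →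
      HasFilteredValue F ε p (_root_.anchorPow p r u • u) (_root_.anchorPow p a x • x) := fun hr =>
    ((hr.anchorPow hε hu p).smul hε hu).congr_degree
      (by rw [add_zero, add_zero, mul_one, Nat.sub_add_cancel (Nat.pos_of_ne_zero hp)])
  have hr' : HasFilteredValue F ε 1 (r • u) (a • x) := (hr.smul hε hu).congr_degree (by omega)
  have hs' : HasFilteredValue F ε 1 (s • u) (b • x) := (hs.smul hε hu).congr_degree (by omega)
  have h2 := hr'.jacobsonSum hε hp hs'
  have h3 := h (hr.add hs)
  exact ((h3.sub (h hr)).sub (h hs)).sub h2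

end HasFilteredValue

/-! ### Vanishing of the defects by specialization. -/

section Specialization

variable {k : Type*} [Field k] {p : ℕ} [Fact p.Prime] [CharP k p]

/-- The pair (ε 1 X, ε 1 1) is (1, 1) for evaluation at 1, (0, 1) for evaluation at 0 and (1, 0) for
the leading coefficient. Attaching X to one argument and 1 to the others therefore reduces an
identity to its two degenerate cases. -/
theorem eq_add_of_polynomial_family {M : Type*} [AddCommGroup M] [Module k M] {z : k[X] ⊗[k] M}
    {f : k → k → M}
    (hz : ∀ ε, IsFilteredPoint (fun n : ℕ => degreeLE k n) ε →
      HasFilteredValue (fun n : ℕ => degreeLE k n) ε p z (f (ε 1 X) (ε 1 1)))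
    (hd : LinearMap.rTensor M (derivative' (R := k) : k[X] →ₗ[k] k[X]) z = 0) :
    f 1 1 = f 0 1 + f 1 0 := by
  have h₁ := hz _ (isFilteredPoint_leval 1)
  have h₀ := hz _ (isFilteredPoint_leval 0)
  have h₂ := hz _ isFilteredPoint_lcoeff
  have := h₁.eq_add_of_derivative_eq_zero h₀ h₂ hd
  simpa [coeff_one] using this

theorem hasFilteredValue_X_tmul {M : Type*} [AddCommGroup M] [Module k M]
    (ε : ℕ → k[X] →ₗ[k] k) (x : M) :
    HasFilteredValue (fun n : ℕ => degreeLE k n) ε 1 ((X : k[X]) ⊗ₜ[k] x) (ε 1 X • x) :=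
  .tmul (mem_degreeLE.2 degree_X_le) x

theorem hasFilteredValue_one_tmul {M : Type*} [AddCommGroup M] [Module k M]
    (ε : ℕ → k[X] →ₗ[k] k) (n : ℕ) (x : M) :
    HasFilteredValue (fun n : ℕ => degreeLE k n) ε n ((1 : k[X]) ⊗ₜ[k] x) (ε n 1 • x) :=
  .tmul (mem_degreeLE.2 (degree_one_le.trans (by exact_mod_cast n.zero_le))) x

variable {L : Type*} [LieRing L] [LieAlgebra k L]

theorem jacobsonSum_comm (x y : L) : jacobsonSum k p x y = jacobsonSum k p y x := by
  have hp := (Fact.out : p.Prime).ne_zero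
  have := eq_add_of_polynomial_family (k := k) (p := p)
    (z := jacobsonCommDefect k p ((X : k[X]) ⊗ₜ[k] x) ((1 : k[X]) ⊗ₜ[k] y))
    (f := fun s t => jacobsonCommDefect k p (s • x) (t • y))
    (fun ε hε => (hasFilteredValue_X_tmul ε x).commDefect hε hp (hasFilteredValue_one_tmul ε 1 y))
    (derivation_jacobsonCommDefect _ (rTensor_derivation_lie derivative') _ _)
  simpa [jacobsonCommDefect, sub_eq_zero] using this

theorem jacobsonSum_cocycle (x y z : L) :
    jacobsonSum k p x y + jacobsonSum k p (x + y) z =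
      jacobsonSum k p y z + jacobsonSum k p x (y + z) := by
  have hp := (Fact.out : p.Prime).ne_zero
  have := eq_add_of_polynomial_family (k := k) (p := p)
    (z := jacobsonCocycleDefect k p ((X : k[X]) ⊗ₜ[k] x) ((1 : k[X]) ⊗ₜ[k] y)
      ((1 : k[X]) ⊗ₜ[k] z))
    (f := fun s t => jacobsonCocycleDefect k p (s • x) (t • y) (t • z))
    (fun ε hε => (hasFilteredValue_X_tmul ε x).cocycleDefect hε hp (hasFilteredValue_one_tmul ε 1 y)
      (hasFilteredValue_one_tmul ε 1 z))
    (derivation_jacobsonCocycleDefect _ (rTensor_derivation_lie derivative') _ _ _)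
  rw [← sub_eq_zero, ← sub_sub]
  simpa [jacobsonCocycleDefect] using this

variable {A : Type*} [CommRing A] [Algebra k A] [Module A L] [LieRingModule L A]
  [LieRinehartRing A L] [LieRinehartAlgebra k A L]

theorem smulAddDefect_eq_zero (hp : 3 ≤ p) (a : A) (x y : L) : smulAddDefect k p a x y = 0 := by
  have hp0 := (Fact.out : p.Prime).ne_zero
  have := eq_add_of_polynomial_family (k := k) (p := p)
    (z := smulAddDefect k p ((1 : k[X]) ⊗ₜ[k] a) ((X : k[X]) ⊗ₜ[k] x) ((1 : k[X]) ⊗ₜ[k] y))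
    (f := fun s t => smulAddDefect k p a (s • x) (t • y))
    (fun ε hε => by
      have h0 := hasFilteredValue_one_tmul ε 0 a
      rw [hε.map_one, one_smul] at h0
      exact h0.smulAddDefect hε hp0 (hasFilteredValue_X_tmul ε x) (hasFilteredValue_one_tmul ε 1 y))
    (derivation_smulAddDefect (Derivation.extendScalars A derivative') _
      (rTensor_derivation_lie derivative') (rTensor_derivation_smul derivative')
      (extendScalars_derivation_lie derivative') hp _ _ _)
  simpa [smulAddDefect] using this

theorem addSmulDefect_eq_zero (hp : 3 ≤ p) (a b : A) (x : L) : addSmulDefect k p a b x = 0 := by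
  have hp0 := (Fact.out : p.Prime).ne_zero
  have := eq_add_of_polynomial_family (k := k) (p := p)
    -- Here the scalars have degree 1 and `x` degree 0, since the defect is homogeneous of degree p
    -- in (a, b) jointly.
    (z := addSmulDefect k p ((X : k[X]) ⊗ₜ[k] a) ((1 : k[X]) ⊗ₜ[k] b) ((1 : k[X]) ⊗ₜ[k] x))
    (f := fun s t => addSmulDefect k p (s • a) (t • b) x)
    (fun ε hε => by
      have h0 := hasFilteredValue_one_tmul ε 0 x
      rw [hε.map_one, one_smul] at h0
      exact (hasFilteredValue_X_tmul ε a).addSmulDefect hε hp0 (hasFilteredValue_one_tmul ε 1 b) h0)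
    (derivation_addSmulDefect (Derivation.extendScalars A derivative') _
      (rTensor_derivation_lie derivative') (rTensor_derivation_smul derivative')
      (extendScalars_derivation_lie derivative') hp _ _ _)
  simpa [addSmulDefect, anchorPow_of_lie_eq_zero (by omega : 2 ≤ p) (lie_zero _)] using this

end Specialization

/-! ### The module of formal `p`-th powers -/

/-- Pairs of an element of `L` and a candidate for its `p`-th power. Addition is the one dictated by
Jacobson's formula and scalar multiplication the one dictated by Hochschild's formula. -/
@[ext] structure PowerPair (k L : Type*) (p : ℕ) where
  base : L
  power : L

namespace PowerPair

section Components

variable {k A L : Type*} {p : ℕ} [LieRing L]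

instance : Zero (PowerPair k L p) := ⟨⟨0, 0⟩⟩

instance : Neg (PowerPair k L p) := ⟨fun e => ⟨-e.base, -e.power⟩⟩

instance [Field k] [LieAlgebra k L] : Add (PowerPair k L p) :=
  ⟨fun e f => ⟨e.base + f.base, e.power + f.power + jacobsonSum k p e.base f.base⟩⟩

instance [CommRing A] [Module A L] [LieRingModule L A] : SMul A (PowerPair k L p) :=
  ⟨fun a e => ⟨a • e.base, a ^ p • e.power + anchorPow p a e.base • e.base⟩⟩

@[simp] theorem zero_base : (0 : PowerPair k L p).base = 0 := rfl
@[simp] theorem zero_power : (0 : PowerPair k L p).power = 0 := rfl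
@[simp] theorem neg_base (e : PowerPair k L p) : (-e).base = -e.base := rfl
@[simp] theorem neg_power (e : PowerPair k L p) : (-e).power = -e.power := rfl

@[simp] theorem add_base [Field k] [LieAlgebra k L] (e f : PowerPair k L p) :
    (e + f).base = e.base + f.base := rfl

@[simp] theorem add_power [Field k] [LieAlgebra k L] (e f : PowerPair k L p) :
    (e + f).power = e.power + f.power + jacobsonSum k p e.base f.base := rfl

variable [CommRing A] [Module A L] [LieRingModule L A]

@[simp] theorem smul_base (a : A) (e : PowerPair k L p) : (a • e).base = a • e.base := rfl

@[simp] theorem smul_power (a : A) (e : PowerPair k L p) :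
    (a • e).power = a ^ p • e.power + anchorPow p a e.base • e.base := rfl

end Components

variable {k A L : Type*} [Field k] [LieRing L] [LieAlgebra k L] {p : ℕ}

instance [Fact p.Prime] [CharP k p] : AddCommGroup (PowerPair k L p) where
  add_assoc e f g := by
    ext
    · simp [add_assoc]
    · have := jacobsonSum_cocycle (k := k) (p := p) e.base f.base g.base
      simp only [add_power, add_base]
      rw [add_right_comm _ g.power, add_assoc _ (jacobsonSum k p e.base f.base), this]
      abel
  zero_add e := by ext <;> simp
  add_zero e := by ext <;> simp
  nsmul := nsmulRec
  zsmul := zsmulRec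
  neg_add_cancel e := by
    ext
    · simp
    · simp [jacobsonSum_of_lie_eq_zero (k := k) (p := p) (x := -e.base) (y := e.base) (by simp)]
  add_comm e f := by
    ext
    · simp [add_comm]
    · simp [add_comm e.power, jacobsonSum_comm e.base]

variable [CommRing A] [Algebra k A] [Module A L] [LieRingModule L A] [LieRinehartRing A L]
  [LieRinehartAlgebra k A L]

theorem lie_algebraMap_eq_zero (c : k) (x : L) : ⁅x, algebraMap k A c⁆ = 0 :=
  (LieRinehartAlgebra.anchor k A L x).map_algebraMap c

theorem ad_pow_apply (x y : L) (n : ℕ) :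
    (LieAlgebra.ad k L x ^ n) y = (lieEnd L x ^ n) y := by
  induction n with
  | zero => rfl
  | succ n ih =>
    rw [pow_succ', Module.End.mul_apply, ih, pow_succ', AddMonoid.End.mul_apply_eq]; rfl

variable [Fact p.Prime] [CharP k p] [Fact (3 ≤ p)]

/-- The two distributive laws are the vanishing of the scalar defects, and associativity is
`iterate_mul_derivation_mul`. The unit law uses that the anchor kills 1. The bound on `p` is a
`Fact` so that instance search can find this structure. -/
instance : Module A (PowerPair k L p) where
  one_smul e := by
    have h : ⁅e.base, (1 : A)⁆ = 0 := by
      rw [← map_one (algebraMap k A)]; exact lie_algebraMap_eq_zero 1 e.base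
    have := anchorPow_of_lie_eq_zero (Fact.out : p.Prime).two_le h
    ext <;> simp [this]
  mul_smul a b e := by
    have hp : 3 ≤ p := Fact.out
    have h := iterate_mul_derivation_mul (natCast_prime_eq_zero k A p) hp
      (LieRinehartAlgebra.anchor k A L e.base) a b
    have h1 : anchorPow p a (b • e.base) =
        (fun c => a * b * (LieRinehartAlgebra.anchor k A L e.base) c)^[p - 1] a := by
      simp only [anchorPow, LieRinehartRing.lie_smul_eq_mul, ← mul_assoc]
      rfl
    have h2 : anchorPow p (a * b) e.base =
        a ^ p * anchorPow p b e.base + anchorPow p a (b • e.base) * b := by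
      rw [h1]; exact h
    ext
    · simp [mul_smul]
    · simp only [smul_power, smul_base, h2, mul_pow]
      module
  smul_zero a := by ext <;> simp
  smul_add a e f := by
    have h := smulAddDefect_eq_zero (k := k) (Fact.out : 3 ≤ p) a e.base f.base
    ext
    · simp
    · rw [smulAddDefect, sub_eq_zero] at h
      simp only [smul_power, smul_base, add_power, add_base, ← h]
      module
  add_smul a b e := by
    have h := addSmulDefect_eq_zero (k := k) (Fact.out : 3 ≤ p) a b e.base
    ext
    · simp [add_smul]
    · rw [addSmulDefect, sub_eq_zero] at h
      simp only [smul_power, smul_base, add_power, ← h, add_pow_prime_of_algebra k p]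
      module
  zero_smul e := by
    have := anchorPow_of_lie_eq_zero (A := A) (Fact.out : p.Prime).two_le (lie_zero e.base)
    ext <;> simp [this, (Fact.out : p.Prime).ne_zero]

variable (k A L p) in
/-- The projection to the first component. -/
def baseHom : PowerPair k L p →ₗ[A] L where
  toFun := base
  map_add' _ _ := rfl
  map_smul' _ _ := rfl

/-- On `A` the anchor is A-linear, so Hochschild's formula applies directly in End_k(A), with `A`
acting by multiplication. -/
theorem toEnd_smul_pow_prime {x x' : L}
    (h : LieModule.toEnd k L A x ^ p = LieModule.toEnd k L A x') (a : A) :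
    LieModule.toEnd k L A (a • x) ^ p =
      LieModule.toEnd k L A (a ^ p • x' + anchorPow p a x • x) := by
  let ι : A →+* Module.End k A := (Algebra.lmul k A : A →ₐ[k] Module.End k A)
  have hι : ∀ (b : A) (z : L), LieModule.toEnd k L A (b • z) = ι b * LieModule.toEnd k L A z :=
    fun b z => LinearMap.ext fun c => LieRinehartRing.lie_smul_eq_mul b c z
  have hx : ∀ b, LieModule.toEnd k L A x * ι b =
      ι b * LieModule.toEnd k L A x + ι ((LieRinehartAlgebra.anchor k A L x) b) := fun b =>
    LinearMap.ext fun c => LieRinehartRing.leibniz_mul_right x b c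
  rw [hι, mul_pow_prime (natCast_prime_eq_zero k A p) Fact.out hx, h, map_add, hι, hι]
  rfl

/-- The adjoint map is not A-linear in its argument, so Hochschild's formula does not apply to it
directly. The differentiated formula for the inner derivation [y, -] is used instead, because
ad_z^p(y) = -ad_z^{p-1}[y, z]. -/
theorem ad_smul_pow_prime {x x' : L}
    (h : LieAlgebra.ad k L x ^ p = LieAlgebra.ad k L x') (a : A) :
    LieAlgebra.ad k L (a • x) ^ p = LieAlgebra.ad k L (a ^ p • x' + anchorPow p a x • x) := by
  ext y
  have hp : p - 1 + 1 = p := Nat.sub_add_cancel (Fact.out : p.Prime).one_le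
  let θ := LieRinehartAlgebra.anchor k A L y
  have key : (lieEnd L (a • x) ^ (p - 1)) ⁅y, a • x⁆ =
      a ^ p • (lieEnd L x ^ (p - 1)) ⁅y, x⁆ + ⁅y, anchorPow p a x • x⁆ :=
    lieEnd_smul_pow_derivation (natCast_prime_eq_zero k A p) Fact.out θ (lieEnd L y)
    (fun b z => LieRinehartRing.leibniz_smul_right y z b) (fun z b => leibniz_lie y z b) a x
  have hpow : ∀ z : L, (lieEnd L z ^ (p - 1)) ⁅y, z⁆ = -(LieAlgebra.ad k L z ^ p) y := by
    intro z
    rw [ad_pow_apply, ← hp, pow_succ, hp, AddMonoid.End.mul_apply_eq, lieEnd_apply, ← map_neg,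
      lie_skew]
  have hθ : ⁅y, a ^ p⁆ = 0 := derivation_pow_prime θ a
  rw [hpow (a • x), hpow x, h, LieAlgebra.ad_apply, neg_eq_iff_eq_neg] at key
  have h1 : ⁅a ^ p • x', y⁆ = a ^ p • ⁅x', y⁆ := by
    rw [← lie_skew, LieRinehartRing.leibniz_smul_right, hθ, zero_smul, add_zero, ← lie_skew x' y,
      smul_neg]
  rw [key, LieAlgebra.ad_apply, add_lie, h1, ← lie_skew (anchorPow p a x • x) y]
  module

variable (k A L p) in
/-- The pairs that satisfy the conditions on `p`-th powers in a restricted Lie–Rinehart algebra. -/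
def restricted : Submodule A (PowerPair k L p) where
  carrier := {e | LieAlgebra.ad k L e.base ^ p = LieAlgebra.ad k L e.power ∧
    LieModule.toEnd k L A e.base ^ p = LieModule.toEnd k L A e.power}
  zero_mem' := by
    have := (Fact.out : p.Prime).ne_zero
    simp [this]
  add_mem' {e f} he hf := by
    constructor
    · rw [add_base, add_power, LieHom.add_pow_eq, he.1, hf.1, map_add, map_add]
    · rw [add_base, add_power, LieHom.add_pow_eq, he.2, hf.2, map_add, map_add]
  smul_mem' a _ he := ⟨ad_smul_pow_prime he.1 a, toEnd_smul_pow_prime he.2 a⟩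

end PowerPair

/-! ### Restricted structures as sections. -/

section Restricted

variable {k A L : Type*} [Field k] [LieRing L] [LieAlgebra k L] {p : ℕ}
  [CommRing A] [Algebra k A] [Module A L] [LieRingModule L A]
  [LieRinehartRing A L] [LieRinehartAlgebra k A L]

theorem anchor_pow_eq_anchorPow (a : A) (x : L) :
    ((LieRinehartAlgebra.anchor k A L (a • x) : Module.End k A) ^ (p - 1)) a = anchorPow p a x := by
  rw [Module.End.pow_apply]
  refine congrFun (congrArg (fun f : A → A => f^[p - 1]) (funext fun b => ?_)) a
  exact LieRinehartRing.lie_smul_eq_mul a b x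

variable [Fact p.Prime] [CharP k p] [Fact (3 ≤ p)]

/-- Sections of the module of formal `p`-th powers are restricted Lie–Rinehart structures. -/
theorem isRestrictedLieRinehart_of_section (s : L →ₗ[A] PowerPair k L p)
    (hbase : ∀ x, (s x).base = x) (hs : ∀ x, s x ∈ PowerPair.restricted k A L p) :
    IsRestrictedLieRinehart k A p fun x => (s x).power where
  isPMap :=
    { ad_pow := fun x => by
        have := (hs x).1
        rwa [hbase] at this
      map_smul := fun c x => by
        have h := anchorPow_of_lie_eq_zero (Fact.out : p.Prime).two_le
          (PowerPair.lie_algebraMap_eq_zero (A := A) c x)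
        rw [← algebraMap_smul A c x, map_smul, PowerPair.smul_power, hbase, h, zero_smul, add_zero,
          ← map_pow, algebraMap_smul]
      map_add := fun x y => by rw [map_add, PowerPair.add_power, hbase, hbase] }
  anchor_map x := by
    have := (hs x).2
    rw [hbase] at this
    exact this.symm
  map_smul a x := by
    rw [map_smul, PowerPair.smul_power, hbase, anchor_pow_eq_anchorPow]

omit [CharP k p] [Fact (3 ≤ p)] in
/-- A restricted Lie–Rinehart structure is determined by its values on a generating set. -/
theorem IsRestrictedLieRinehart.ext_of_span {ψ ψ' : L → L} (h : IsRestrictedLieRinehart k A p ψ)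
    (h' : IsRestrictedLieRinehart k A p ψ') {S : Set L} (hS : Submodule.span A S = ⊤)
    (heq : Set.EqOn ψ ψ' S) : ψ = ψ' := by
  have h0 : ∀ {ψ : L → L}, IsRestrictedLieRinehart k A p ψ → ψ 0 = 0 := fun h => by
    simpa [(Fact.out : p.Prime).ne_zero] using h.isPMap.map_smul 0 0
  funext x
  have hx : x ∈ Submodule.span A S := hS ▸ Submodule.mem_top
  induction hx using Submodule.span_induction with
  | mem x hx => exact heq hx
  | zero => rw [h0 h, h0 h']
  | add x y _ _ hx hy => rw [h.isPMap.map_add, h'.isPMap.map_add, hx, hy]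
  | smul a x _ hx => rw [h.map_smul, h'.map_smul, hx]

end Restricted

open KaehlerDifferential (D)

/-! ### Kähler differentials of weakly restricted Poisson algebras -/

namespace PoissonAlgebra

variable {k A : Type*} [Field k] [PoissonRing A] [PoissonAlgebra k A]

theorem omega_D_lie_smul (u x : A) (ω : Ω[A⁄k]) :
    ⁅D k A u, x • ω⁆ = x • ⁅D k A u, ω⁆ + ⁅u, x⁆ • ω := by
  rw [omega_lie_smul, omegaAnchor_D, hamiltonian_apply]

theorem omega_D_lie_apply (u x : A) : ⁅D k A u, x⁆ = ⁅u, x⁆ := by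
  rw [omega_lie_apply, omegaAnchor_D, hamiltonian_apply]

theorem omega_D_lie_D (u v : A) : ⁅D k A u, D k A v⁆ = D k A ⁅u, v⁆ := by
  have h (x : A) : ⁅x, (1 : A)⁆ = 0 := (hamiltonian k x).map_one_eq_zero
  have h' (x : A) : ⁅(1 : A), x⁆ = 0 := by rw [← lie_skew, h, neg_zero]
  simpa [h, h'] using omega_lie_smul_D (k := k) 1 u 1 v

variable (k A) in
/-- The universal derivation of a Poisson algebra as a homomorphism of Lie algebras. -/
noncomputable def omegaDLieHom : A →ₗ⁅k⁆ Ω[A⁄k] where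
  toLinearMap := (D k A : A →ₗ[k] Ω[A⁄k])
  map_lie' {u v} := (omega_D_lie_D u v).symm

variable {p : ℕ} {φ : A → A}

variable (φ p) in
/-- The pair of `du` and `d (φ u)`. -/
noncomputable def powerPairD (u : A) : PowerPair k Ω[A⁄k] p := ⟨D k A u, D k A (φ u)⟩

/-- The universal derivation is a Lie homomorphism, so it carries the Jacobson sum of `A` to that of
Ω. -/
theorem powerPairD_add (hφ : IsPMap k p φ) (u v : A) :
    powerPairD (k := k) p φ (u + v) = powerPairD p φ u + powerPairD p φ v := by
  ext
  · exact map_add (D k A) u v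
  · change D k A (φ (u + v)) = D k A (φ u) + D k A (φ v) + jacobsonSum k p (D k A u) (D k A v)
    rw [hφ.map_add, map_add, map_add]
    exact congrArg _ ((omegaDLieHom k A).map_jacobsonSum u v)

theorem anchor_one_smul_pow (hp : 2 ≤ p) (ω : Ω[A⁄k]) : anchorPow p (1 : A) ω = 0 :=
  anchorPow_of_lie_eq_zero hp (by
    simpa using PowerPair.lie_algebraMap_eq_zero (A := A) (1 : k) ω)

variable [Fact p.Prime]

theorem powerPairD_smul (hφ : IsPMap k p φ) (c : k) (u : A) :
    powerPairD (k := k) p φ (c • u) = algebraMap k A c • powerPairD p φ u := by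
  have h := anchorPow_of_lie_eq_zero (Fact.out : p.Prime).two_le
    (PowerPair.lie_algebraMap_eq_zero (A := A) c (D k A u))
  ext
  · change D k A (c • u) = algebraMap k A c • D k A u
    rw [Derivation.map_smul, algebraMap_smul]
  · change D k A (φ (c • u)) = algebraMap k A c ^ p • D k A (φ u) +
      anchorPow p (algebraMap k A c) (D k A u) • D k A u
    rw [hφ.map_smul, Derivation.map_smul, h, zero_smul, add_zero, ← map_pow, algebraMap_smul]

variable [CharP k p]

/-- In characteristic p, the p-th power of ad(du) obeys the Leibniz rule over {u, -}^p = {φ u, -}.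
It therefore agrees with ad(d(φ u)) on all x dv as soon as it does on exact forms, where it is
computed in `A`. -/
theorem ad_D_pow_prime (hφ : IsPMap k p φ) (u : A) :
    LieAlgebra.ad k Ω[A⁄k] (D k A u) ^ p = LieAlgebra.ad k Ω[A⁄k] (D k A (φ u)) := by
  have had : ∀ x : A, (hamiltonian k u)^[p] x = ⁅φ u, x⁆ := fun x => by
    have := LinearMap.congr_fun (hφ.ad_pow u) x
    rw [Module.End.pow_apply] at this
    exact this
  have hD : ∀ (n : ℕ) (v : A), (lieEnd Ω[A⁄k] (D k A u) ^ n) (D k A v) =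
      D k A ((hamiltonian k u)^[n] v) := by
    intro n v
    induction n with
    | zero => rfl
    | succ n ih =>
      rw [pow_succ', AddMonoid.End.mul_apply_eq, ih, lieEnd_apply, omega_D_lie_D,
        Function.iterate_succ_apply']
      rfl
  have hx : ∀ b, lieEnd Ω[A⁄k] (D k A u) * Module.toAddMonoidEnd A Ω[A⁄k] b =
      Module.toAddMonoidEnd A Ω[A⁄k] b * lieEnd Ω[A⁄k] (D k A u) +
        Module.toAddMonoidEnd A Ω[A⁄k] (hamiltonian k u b) := fun b => by
    ext ω
    exact omega_D_lie_smul u b ω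
  have key := pow_prime_mul (p := p)
    (natCast_addEnd_eq_zero (A := A) (natCast_prime_eq_zero k A p)) hx
  refine LinearMap.ext fun ω => ?_
  induction ω using kaehler_induction with
  | h0 => simp
  | hadd a b ha hb => rw [map_add, ha, hb, map_add]
  | hD x v =>
    rw [PowerPair.ad_pow_apply]
    refine (DFunLike.congr_fun (key x) (D k A v)).trans ?_
    change x • (lieEnd Ω[A⁄k] (D k A u) ^ p) (D k A v) + ((hamiltonian k u)^[p] x) • D k A v = _
    rw [hD, had, had, LieAlgebra.ad_apply, omega_D_lie_smul, omega_D_lie_D]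

/-- The Hochschild term vanishes because {u, 2u} = 0. The other terms match because d(u^p) = 0 and
2^p = 2 in `A`. -/
theorem powerPairD_sq (hφ : IsRestrictedPoisson k p φ) (u : A) :
    powerPairD (k := k) p φ (u ^ 2) = (2 * u) • powerPairD p φ u := by
  have h2 : (2 : A) ^ p = 2 := by
    rw [← one_add_one_eq_two, add_pow_prime_of_algebra k p, one_pow]
  have hlie : ⁅D k A u, 2 * u⁆ = 0 := by
    rw [omega_D_lie_apply, two_mul, lie_add, lie_self, add_zero]
  have h := anchorPow_of_lie_eq_zero (Fact.out : p.Prime).two_le hlie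
  ext
  · change D k A (u ^ 2) = (2 * u) • D k A u
    rw [Derivation.leibniz_pow]
    simp [mul_smul, two_smul]
  · change D k A (φ (u ^ 2)) = (2 * u) ^ p • D k A (φ u) + anchorPow p (2 * u) (D k A u) • D k A u
    have hD : D k A (2 * u ^ p) = 0 := by
      rw [Derivation.leibniz, Derivation.leibniz_pow, ← Nat.cast_smul_eq_nsmul A,
        natCast_prime_eq_zero k A p, zero_smul, smul_zero, zero_add, ← Nat.cast_two,
        Derivation.map_natCast, smul_zero]
    rw [hφ.map_sq, Derivation.leibniz, hD, smul_zero, add_zero, h, zero_smul, add_zero, mul_pow, h2]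

variable [Fact (3 ≤ p)]

theorem powerPairD_mem_restricted (hφ : IsPMap k p φ) (u : A) :
    powerPairD p φ u ∈ PowerPair.restricted k A Ω[A⁄k] p := by
  refine ⟨ad_D_pow_prime hφ u, ?_⟩
  have h : ∀ v : A, LieModule.toEnd k Ω[A⁄k] A (D k A v) = LieAlgebra.ad k A v := fun v =>
    LinearMap.ext fun x => omega_D_lie_apply v x
  change LieModule.toEnd k Ω[A⁄k] A (D k A u) ^ p = LieModule.toEnd k Ω[A⁄k] A (D k A (φ u))
  rw [h, h]
  exact hφ.ad_pow u

theorem span_range_D : Submodule.span A (Set.range fun u : A => D k A u) = ⊤ :=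
  KaehlerDifferential.span_range_derivation k A

/-- A section of the module of formal `p`-th powers over `Ω[A⁄k]` determines a restricted
Lie–Rinehart structure if it is restricted on a generating set. -/
theorem isRestrictedLieRinehart_of_generators (s : Ω[A⁄k] →ₗ[A] PowerPair k Ω[A⁄k] p)
    {S : Set Ω[A⁄k]} (hS : Submodule.span A S = ⊤) (hbase : ∀ ω ∈ S, (s ω).base = ω)
    (hs : ∀ ω ∈ S, s ω ∈ PowerPair.restricted k A Ω[A⁄k] p) :
    IsRestrictedLieRinehart k A p fun ω => (s ω).power := by
  refine isRestrictedLieRinehart_of_section s (fun ω => ?_) (fun ω => ?_)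
  · exact LinearMap.congr_fun (LinearMap.ext_on hS
      (f := PowerPair.baseHom k A Ω[A⁄k] p ∘ₗ s) (g := LinearMap.id) hbase) ω
  · have h : Submodule.span A S ≤ (PowerPair.restricted k A Ω[A⁄k] p).comap s :=
      Submodule.span_le.2 hs
    exact h (hS ▸ Submodule.mem_top)

/-- Polarisation of the rule for squares: additivity of `powerPairD` is available, and 2 is
invertible because p is odd. -/
theorem powerPairD_mul (hφ : IsRestrictedPoisson k p φ) (u v : A) :
    powerPairD (k := k) p φ (u * v) = u • powerPairD p φ v + v • powerPairD p φ u := by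
  have hw : IsPMap k p φ := hφ.weaklyRestricted
  have h := powerPairD_sq (k := k) hφ (u + v)
  rw [show (u + v) ^ 2 = u ^ 2 + v ^ 2 + (u * v + u * v) by ring, powerPairD_add hw,
    powerPairD_add hw, powerPairD_add hw, powerPairD_add hw, powerPairD_sq hφ,
    powerPairD_sq hφ] at h
  have hu : IsUnit ((2 : ℕ) : A) := isUnit_natCast_of_coprime (natCast_prime_eq_zero k A p)
    ((Nat.coprime_primes Nat.prime_two Fact.out).2 (by
      have : 3 ≤ p := Fact.out
      omega))
  have h2 : ((2 : ℕ) : A) • powerPairD (k := k) p φ (u * v) =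
      ((2 : ℕ) : A) • (u • powerPairD p φ v + v • powerPairD p φ u) := by
    have : ((2 : ℕ) : A) • powerPairD (k := k) p φ (u * v) =
        powerPairD p φ (u * v) + powerPairD p φ (u * v) := by
      rw [Nat.cast_two, two_smul]
    rw [this, ← sub_eq_zero, ← sub_eq_zero.2 h, Nat.cast_two]
    module
  exact hu.smul_left_cancel.1 h2

theorem exists_section_of_restrictedPoisson (hφ : IsRestrictedPoisson k p φ) :
    ∃ s : Ω[A⁄k] →ₗ[A] PowerPair k Ω[A⁄k] p, ∀ u, s (D k A u) = powerPairD p φ u := by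
  -- The k-action on pairs is restricted from `A`, so that `powerPairD p φ` becomes a k-linear
  -- derivation.
  let _ : Module k (PowerPair k Ω[A⁄k] p) := Module.compHom _ (algebraMap k A)
  have _ : IsScalarTower k A (PowerPair k Ω[A⁄k] p) :=
    ⟨fun c a e => by rw [Algebra.smul_def, mul_smul]; rfl⟩
  let δ : Derivation k A (PowerPair k Ω[A⁄k] p) := Derivation.mk'
    { toFun := powerPairD p φ
      map_add' := powerPairD_add hφ.weaklyRestricted
      map_smul' := powerPairD_smul hφ.weaklyRestricted } (powerPairD_mul hφ)
  exact ⟨δ.liftKaehlerDifferential, δ.liftKaehlerDifferential_comp_D⟩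

end PoissonAlgebra

/-! ### The theorem. -/

open PoissonAlgebra in
theorem theorem8p2 {k A : Type*} [Field k] (p : ℕ) [Fact p.Prime] [CharP k p] (hp : 3 ≤ p)
    [PoissonRing A] [PoissonAlgebra k A] [Module.Free A Ω[A⁄k]]
    (φ : A → A) (hφ : IsWeaklyRestrictedPoisson k p φ) :
    (∃ ψ : Ω[A⁄k] → Ω[A⁄k], IsRestrictedLieRinehart k A p ψ) ∧
    (∀ (ι : Type*) (u : ι → A) (b : Module.Basis ι A Ω[A⁄k]),
      (∀ i, b i = KaehlerDifferential.D k A (u i)) →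
      ∃! ψ : Ω[A⁄k] → Ω[A⁄k], IsRestrictedLieRinehart k A p ψ ∧
        ∀ (x : A) (i : ι), ψ (x • KaehlerDifferential.D k A (u i)) =
          x ^ p • KaehlerDifferential.D k A (φ (u i)) +
            ((LieRinehartAlgebra.anchor k A Ω[A⁄k] (x • KaehlerDifferential.D k A (u i)) :
              Module.End k A) ^ (p - 1)) x • KaehlerDifferential.D k A (u i)) ∧
    (IsRestrictedPoisson k p φ →
      ∃! ψ : Ω[A⁄k] → Ω[A⁄k], IsRestrictedLieRinehart k A p ψ ∧
        ∀ x u : A, ψ (x • KaehlerDifferential.D k A u) =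
          x ^ p • KaehlerDifferential.D k A (φ u) +
            ((LieRinehartAlgebra.anchor k A Ω[A⁄k] (x • KaehlerDifferential.D k A u) :
              Module.End k A) ^ (p - 1)) x • KaehlerDifferential.D k A u) := by

  have _ : Fact (3 ≤ p) := ⟨hp⟩
  have hw : IsPMap k p φ := hφ
  -- At x = 1 the Hochschild term vanishes, so the prescribed formula fixes the value on du. This is
  -- what both uniqueness claims need.
  have hone : ∀ {ψ : Ω[A⁄k] → Ω[A⁄k]} {u : A},
      (∀ x : A, ψ (x • D k A u) = x ^ p • D k A (φ u) +
        ((LieRinehartAlgebra.anchor k A Ω[A⁄k] (x • D k A u) : Module.End k A) ^ (p - 1)) x •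
          D k A u) → ψ (D k A u) = D k A (φ u) := by
    intro ψ u h
    have := h 1
    rwa [anchor_pow_eq_anchorPow, anchor_one_smul_pow (by omega), one_pow, one_smul, one_smul,
      zero_smul, add_zero] at this
  refine ⟨?_, fun ι u b hb => ?_, fun hφ' => ?_⟩
  · let E := PowerPair.restricted k A Ω[A⁄k] p
    let f : E →ₗ[A] Ω[A⁄k] := PowerPair.baseHom k A Ω[A⁄k] p ∘ₗ E.subtype
    have hf : Function.Surjective f := by
      rw [← LinearMap.range_eq_top, eq_top_iff, ← span_range_D, Submodule.span_le]
      rintro _ ⟨u, rfl⟩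
      exact ⟨⟨powerPairD p φ u, powerPairD_mem_restricted hw u⟩, rfl⟩
    -- Freeness enters through projectivity: the projection from the restricted pairs onto Ω splits.
    obtain ⟨s, hs⟩ := Module.projective_lifting_property f LinearMap.id hf
    exact ⟨_, isRestrictedLieRinehart_of_section (E.subtype ∘ₗ s) (LinearMap.congr_fun hs)
      fun ω => (s ω).2⟩
  · let s : Ω[A⁄k] →ₗ[A] PowerPair k Ω[A⁄k] p := b.constr A fun i => powerPairD p φ (u i)
    have hs : ∀ i, s (D k A (u i)) = powerPairD p φ (u i) := fun i => by
      rw [← hb, Module.Basis.constr_basis]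
    have hspan : Submodule.span A (Set.range fun i => D k A (u i)) = ⊤ := by
      rw [← funext hb]; exact b.span_eq
    have hψ := isRestrictedLieRinehart_of_generators s hspan
      (by rintro _ ⟨i, rfl⟩; exact congrArg PowerPair.base (hs i))
      (by rintro _ ⟨i, rfl⟩; rw [hs]; exact powerPairD_mem_restricted hw _)
    refine ⟨_, ⟨hψ, fun x i => ?_⟩, fun ψ h => h.1.ext_of_span hψ hspan ?_⟩
    -- The values on basis elements suffice, since the scalar rule of a restricted structure
    -- supplies the formula for every x.
    · rw [hψ.map_smul, hs]; rfl
    · rintro _ ⟨i, rfl⟩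
      exact (hone fun x => h.2 x i).trans (congrArg PowerPair.power (hs i)).symm
  · obtain ⟨s, hs⟩ := exists_section_of_restrictedPoisson hφ'
    have hψ := isRestrictedLieRinehart_of_generators s span_range_D
      (by rintro _ ⟨u, rfl⟩; exact congrArg PowerPair.base (hs u))
      (by rintro _ ⟨u, rfl⟩; rw [hs]; exact powerPairD_mem_restricted hw _)
    refine ⟨_, ⟨hψ, fun x u => ?_⟩, fun ψ h => h.1.ext_of_span hψ span_range_D ?_⟩
    · rw [hψ.map_smul, hs]; rfl
    · rintro _ ⟨u, rfl⟩
      exact (hone fun x => h.2 x u).trans (congrArg PowerPair.power (hs u)).symm
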